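/- Poincaré inequality for Poisson processes. Let $(\mathbb X,\mathcal X,\mu)$ be a $\sigma$-finite measure space, and let $\mathbf N_\sigma$ be the space of all $\sigma$-finite measures $\chi$ on $\mathbb X$ with $\chi(B)\in\{0,1,2,\dots\}\cup\{\infty\}$ for all $B\in\mathcal X$, equipped with the smallest $\sigma$-field that makes all maps $\chi\mapsto\chi(B)$, $B\in\mathcal X$, measurable. Let $\eta$ be a Poisson process on $\mathbb X$ with intensity measure $\mu$, that is, a random element of $\mathbf N_\sigma$, defined on a probability space $(\Omega,\mathcal A,\mathbb P)$, such that $\eta(B_1),\dots,\eta(B_m)$ are independent whenever $B_1,\dots,B_m\in\mathcal X$ are pairwise disjoint, and $\mathbb P(\eta(B)=k)=\frac{\mu(B)^k}{k!}e^{-\mu(B)}$ for all $B\in\mathcal X$ and $k\in\{0,1,2,\dots\}$ (interpreted as $0$ if $\mu(B)=\infty$). Let $F\in L^2_\eta$, that is, $F$ is a real random variable with $\mathbb E F^2<\infty$ such that $F=f(\eta)$ almost surely for some measurable $f:\mathbf N_\sigma\to\mathbb R$. For any such $f$ and $x\in\mathbb X$ put $D_xF:=f(\eta+\delta_x)-f(\eta)$.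 Then $$\operatorname{Var}F\le\mathbb E\int_{\mathbb X}(D_xF)^2\,\mu(dx),$$ where the right-hand side may be infinite. -/

import Mathlib

open MeasureTheory ProbabilityTheory

/-- The property of being a `σ`-finite measure with values in `{0, 1, 2, …} ∪ {∞}`. -/
def IsCountingType {X : Type*} [MeasurableSpace X] (χ : Measure X) : Prop :=
  SigmaFinite χ ∧ ∀ B : Set X, MeasurableSet B → χ B = ⊤ ∨ ∃ k : ℕ, χ B = (k : ENNReal)

/-- The space `N_σ(X)` of all `σ`-finite measures on `X` with values in `{0, 1, 2, …} ∪ {∞}`.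
As a subtype of `Measure X` it carries the smallest `σ`-field that makes the evaluations
`χ ↦ χ B`, `B` measurable, measurable. -/
abbrev PointMeasure (X : Type*) [MeasurableSpace X] : Type _ :=
  {χ : Measure X // IsCountingType χ}

theorem IsCountingType.add_dirac {X : Type*} [MeasurableSpace X] {χ : Measure X}
    (h : IsCountingType χ) (x : X) : IsCountingType (χ + Measure.dirac x) := by
  obtain ⟨h1, h2⟩ := h
  refine ⟨inferInstance, fun B hB => ?_⟩
  rw [Measure.add_apply, Measure.dirac_apply' x hB]
  rcases h2 B hB with h3 | ⟨k, h3⟩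
  · left
    simp [h3]
  · right
    by_cases hx : x ∈ B
    · exact ⟨k + 1, by simp [h3, hx]⟩
    · exact ⟨k, by simp [h3, hx]⟩

/-- The point measure `χ + δ_x`. -/
noncomputable def PointMeasure.addDirac {X : Type*} [MeasurableSpace X]
    (χ : PointMeasure X) (x : X) : PointMeasure X :=
  ⟨χ.1 + Measure.dirac x, χ.2.add_dirac x⟩

/-- The difference operator `D_x f (χ) = f (χ + δ_x) - f (χ)`. -/
noncomputable def differenceOp {X : Type*} [MeasurableSpace X]
    (x : X) (f : PointMeasure X → ℝ) (χ : PointMeasure X) : ℝ :=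
  f (χ.addDirac x) - f χ

/-- `η` is a Poisson process on `X` with intensity measure `μ`, defined on the probability space
`(Ω, P)`: a random element of `N_σ(X)` with independent increments such that `η(B)` has the
Poisson distribution with parameter `μ(B)`, where this means that `η(B)` takes each finite value
with probability `0` if `μ(B) = ∞`. -/
structure IsPoissonProcess {X Ω : Type*} [MeasurableSpace X] [MeasurableSpace Ω]
    (P : Measure Ω) (μ : Measure X) (η : Ω → PointMeasure X) : Prop where
  measurable : Measurable η
  indep_increments : ∀ (m : ℕ) (B : Fin m → Set X), (∀ i, MeasurableSet (B i)) →
    (∀ i j, i ≠ j → Disjoint (B i) (B j)) → iIndepFun (fun i ω => (η ω).1 (B i)) P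
  poisson : ∀ B : Set X, MeasurableSet B → μ B ≠ ⊤ → ∀ k : ℕ,
    P {ω | (η ω).1 B = (k : ENNReal)} =
      ENNReal.ofReal ((μ B).toReal ^ k / (k.factorial : ℝ) * Real.exp (-(μ B).toReal))
  poisson_top : ∀ B : Set X, MeasurableSet B → μ B = ⊤ → ∀ k : ℕ,
    P {ω | (η ω).1 B = (k : ENNReal)} = 0

/-- `f` is a representative of the random variable `F`: `f` is a real-valued measurable function
on `N_σ(X)` with `F = f(η)` almost surely. -/
def IsRepresentative {X Ω : Type*} [MeasurableSpace X] [MeasurableSpace Ω]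
    (P : Measure Ω) (η : Ω → PointMeasure X) (F : Ω → ℝ) (f : PointMeasure X → ℝ) : Prop :=
  Measurable f ∧ ∀ᵐ ω ∂P, F ω = f (η ω)

/-- `F ∈ L²_η`: `F` is a square integrable random variable that has a representative. -/
def MemL2Eta {X Ω : Type*} [MeasurableSpace X] [MeasurableSpace Ω]
    (P : Measure Ω) (η : Ω → PointMeasure X) (F : Ω → ℝ) : Prop :=
  MemLp F 2 P ∧ ∃ f : PointMeasure X → ℝ, IsRepresentative P η F f

/-! Finite intensity. Let `ν` have mass Λ and put A g(χ) = ∫ g(χ + δ_x) ν(dx). The Poisson law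
integrates g to e^{-Λ} Σ A^k g/k! at the empty configuration, that is, to e^{A-Λ} g, the limit of
K^n g with K = 1 + (A - Λ)/n. For n ≥ max(Λ, 1) the operator K is Markov. With Γf(χ) = ∫ (D_x f(χ))²
ν(dx), a single step satisfies K(f²) - (Kf)² ≤ Γf/n (`step_sq_sub_sq_le`). Since shifts commute, D_x
commutes with K, and Jensen gives Γ(Kf) ≤ KΓf (`carre_step_le`). Summing the variance created at
each of the n steps (`step_pow_variance_le`) and letting n → ∞ gives the Poincaré inequality
(`poissonShiftLaw_variance_le`).

σ-finite intensity. Characteristic functionals show that the law of `η` does not change when its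
points in a set S with μ(S) < ∞ are replaced by an independent Poisson process of intensity μ
restricted to S (`IsPoissonProcess.map_glue`). Given the points outside S, the finite case bounds
the conditional variance of f. The variance of the conditional mean is at most E(f - h)² for every h
depending only on the points in S (`IsPoissonProcess.variance_le_carre_add`). Taking for h a
truncated conditional expectation, Lévy's upward theorem makes this error vanish as S increases to
the whole space. Truncation then passes from bounded f to square integrable f. -/

/-- The algebra of bounded measurable real functions. -/
def boundedMeasurable (E : Type*) [MeasurableSpace E] : Subalgebra ℝ (E → ℝ) where
  carrier := {f | Measurable f ∧ ∃ C, ∀ x, |f x| ≤ C}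
  mul_mem' := by
    rintro f g ⟨hf, C, hC⟩ ⟨hg, D, hD⟩
    refine ⟨hf.mul hg, C * D, fun x => ?_⟩
    rw [Pi.mul_apply, abs_mul]
    exact mul_le_mul (hC x) (hD x) (abs_nonneg _) ((abs_nonneg _).trans (hC x))
  add_mem' := by
    rintro f g ⟨hf, C, hC⟩ ⟨hg, D, hD⟩
    exact ⟨hf.add hg, C + D, fun x => (abs_add_le _ _).trans (add_le_add (hC x) (hD x))⟩
  algebraMap_mem' := fun r => ⟨measurable_const, |r|, fun _ => le_rfl⟩

/-! ### Commuting shifts driven by a finite measure: discrete Markov steps and their limit -/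

namespace boundedMeasurable

variable {E X : Type*} [MeasurableSpace E] [MeasurableSpace X]

theorem measurable_coe (f : boundedMeasurable E) : Measurable (f : E → ℝ) := f.2.1

theorem exists_bound (f : boundedMeasurable E) : ∃ C, 0 ≤ C ∧ ∀ x, |(f : E → ℝ) x| ≤ C := by
  obtain ⟨C, hC⟩ := f.2.2
  exact ⟨max C 0, le_max_right _ _, fun x => (hC x).trans (le_max_left _ _)⟩

theorem integrable_comp (f : boundedMeasurable E) {ν : Measure X} [IsFiniteMeasure ν] {g : X → E}
    (hg : Measurable g) : Integrable (fun x => (f : E → ℝ) (g x)) ν := by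
  obtain ⟨C, -, hC⟩ := exists_bound f
  exact Integrable.of_bound ((measurable_coe f).comp hg).aestronglyMeasurable C
    (Filter.Eventually.of_forall fun x => hC _)

variable {T : E → X → E} (hT : Measurable (Function.uncurry T)) (ν : Measure X) [IsFiniteMeasure ν]

/-- The operator `g ↦ (χ ↦ ∫ g (T χ x) ν(dx))`. -/
noncomputable def shiftIntegral : Module.End ℝ (boundedMeasurable E) where
  toFun g := ⟨fun χ => ∫ x, (g : E → ℝ) (T χ x) ∂ν, by
    refine ⟨?_, ?_⟩
    · exact (StronglyMeasurable.integral_prod_right (ν := ν)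
        (f := fun χ x => (g : E → ℝ) (T χ x))
        ((measurable_coe g).comp hT).stronglyMeasurable).measurable
    · obtain ⟨C, hC0, hC⟩ := exists_bound g
      refine ⟨C * ν.real Set.univ, fun χ => ?_⟩
      exact norm_integral_le_of_norm_le_const (f := fun x => (g : E → ℝ) (T χ x))
        (Filter.Eventually.of_forall fun x => hC _)⟩
  map_add' f g := by
    ext χ
    exact integral_add (integrable_comp f (hT.comp measurable_prodMk_left))
      (integrable_comp g (hT.comp measurable_prodMk_left))
  map_smul' c f := by
    ext χ
    exact integral_const_mul _ _

theorem shiftIntegral_apply (g : boundedMeasurable E) (χ : E) :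
    (shiftIntegral hT ν g : E → ℝ) χ = ∫ x, (g : E → ℝ) (T χ x) ∂ν := rfl

theorem shiftIntegral_nonneg {g : boundedMeasurable E} (hg : ∀ χ, 0 ≤ (g : E → ℝ) χ) (χ : E) :
    0 ≤ (shiftIntegral hT ν g : E → ℝ) χ := integral_nonneg fun _ => hg _

theorem abs_shiftIntegral_pow_le (g : boundedMeasurable E) {C : ℝ} (k : ℕ)
    (hC : ∀ χ, |(g : E → ℝ) χ| ≤ C) (χ : E) :
    |((shiftIntegral hT ν ^ k) g : E → ℝ) χ| ≤ C * ν.real Set.univ ^ k := by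
  induction k generalizing g C with
  | zero => simpa using hC χ
  | succ k ih =>
    rw [pow_succ, Module.End.mul_apply]
    refine (ih (shiftIntegral hT ν g) (C := C * ν.real Set.univ) fun χ => ?_).trans
      (by rw [pow_succ']; linarith)
    exact norm_integral_le_of_norm_le_const (f := fun x => (g : E → ℝ) (T χ x))
      (Filter.Eventually.of_forall fun x => hC _)

/-- The integral of the squared differences, `χ ↦ ∫ (f (T χ x) - f χ)² ν(dx)`. -/
noncomputable def carre (f : boundedMeasurable E) : boundedMeasurable E :=
  -- The square is expanded so that boundedness and measurability come from the algebra.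
  shiftIntegral hT ν (f ^ 2) - (2 : ℝ) • (f * shiftIntegral hT ν f) + ν.real Set.univ • f ^ 2

theorem carre_apply (f : boundedMeasurable E) (χ : E) :
    (carre hT ν f : E → ℝ) χ = ∫ x, ((f : E → ℝ) (T χ x) - (f : E → ℝ) χ) ^ 2 ∂ν := by
  have hm : Measurable (T χ) := hT.comp measurable_prodMk_left
  have h1 := integrable_comp (f ^ 2) (ν := ν) hm
  have h2 := integrable_comp f (ν := ν) hm
  have : (fun x => ((f : E → ℝ) (T χ x) - (f : E → ℝ) χ) ^ 2) = fun x =>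
      (((f ^ 2 : boundedMeasurable E) : E → ℝ) (T χ x) - (2 * (f : E → ℝ) χ) * (f : E → ℝ) (T χ x))
        + (f : E → ℝ) χ ^ 2 := by
    ext x
    simp
    ring
  rw [this, integral_add (f := fun x => ((f ^ 2 : boundedMeasurable E) : E → ℝ) (T χ x) -
    (2 * (f : E → ℝ) χ) * (f : E → ℝ) (T χ x)) (h1.sub (h2.const_mul _)) (integrable_const _),
    integral_sub h1 (h2.const_mul _), integral_const_mul, integral_const]
  simp [carre, shiftIntegral_apply]
  ring

theorem carre_nonneg (f : boundedMeasurable E) (χ : E) : 0 ≤ (carre hT ν f : E → ℝ) χ := by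
  rw [carre_apply]
  exact integral_nonneg fun _ => sq_nonneg _

/-- The one-step operator `(1 - h ν(X)) + h A`. -/
noncomputable def step (h : ℝ) : Module.End ℝ (boundedMeasurable E) :=
  h • shiftIntegral hT ν + (1 - h * ν.real Set.univ) • 1

theorem step_apply (h : ℝ) (f : boundedMeasurable E) (χ : E) :
    (step hT ν h f : E → ℝ) χ = h * (shiftIntegral hT ν f : E → ℝ) χ +
      (1 - h * ν.real Set.univ) * (f : E → ℝ) χ := rfl

variable {h : ℝ} (h0 : 0 ≤ h) (h1 : h * ν.real Set.univ ≤ 1)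
include h0 h1

theorem step_pow_nonneg (n : ℕ) {g : boundedMeasurable E} (hg : ∀ χ, 0 ≤ (g : E → ℝ) χ) (χ : E) :
    0 ≤ ((step hT ν h ^ n) g : E → ℝ) χ := by
  induction n generalizing g with
  | zero => exact hg χ
  | succ n ih =>
    rw [pow_succ, Module.End.mul_apply]
    refine ih fun χ => ?_
    rw [step_apply]
    have := shiftIntegral_nonneg hT ν hg χ
    have := hg χ
    have : 0 ≤ 1 - h * ν.real Set.univ := by linarith
    positivity

theorem step_pow_mono (n : ℕ) {f g : boundedMeasurable E}
    (hg : ∀ χ, (f : E → ℝ) χ ≤ (g : E → ℝ) χ) (χ : E) :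
    ((step hT ν h ^ n) f : E → ℝ) χ ≤ ((step hT ν h ^ n) g : E → ℝ) χ := by
  have := step_pow_nonneg hT ν h0 h1 n (g := g - f) (fun χ => by simpa using hg χ) χ
  rw [map_sub] at this
  simpa using this

-- The two sides differ exactly by the square of h(Af - Λf), where A is the shift integral and Λ the
-- mass of `ν`.
omit h0 h1 in
theorem step_sq_sub_sq_le (f : boundedMeasurable E) (χ : E) :
    ((step hT ν h (f ^ 2) - step hT ν h f ^ 2 : boundedMeasurable E) : E → ℝ) χ ≤
      ((h • carre hT ν f : boundedMeasurable E) : E → ℝ) χ := by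
  simp only [carre, AddSubgroupClass.coe_sub, Pi.sub_apply, step_apply, Subalgebra.coe_smul,
    Subalgebra.coe_add, Subalgebra.coe_pow, Subalgebra.coe_mul, Pi.add_apply, Pi.smul_apply,
    Pi.mul_apply, Pi.pow_apply, smul_eq_mul]
  nlinarith [sq_nonneg (h * ((shiftIntegral hT ν f : E → ℝ) χ - ν.real Set.univ * (f : E → ℝ) χ))]

/-- Jensen for the probability that puts mass h`ν` on the values of `v` and the remaining mass on
`u`: the variance about the mean c is nonnegative. -/
theorem sq_convex_integral_le {u : ℝ} {v : X → ℝ} (hv : Integrable v ν)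
    (hv2 : Integrable (fun x => v x ^ 2) ν) :
    (h * ∫ y, v y ∂ν + (1 - h * ν.real Set.univ) * u) ^ 2 ≤
      h * ∫ y, v y ^ 2 ∂ν + (1 - h * ν.real Set.univ) * u ^ 2 := by
  set c := h * ∫ y, v y ∂ν + (1 - h * ν.real Set.univ) * u with hc
  have hn : 0 ≤ ∫ y, (v y - c) ^ 2 ∂ν := integral_nonneg fun _ => sq_nonneg _
  have : (fun y => (v y - c) ^ 2) = fun y => (v y ^ 2 - (2 * c) * v y) + c ^ 2 := by
    ext y
    ring
  rw [this, integral_add (f := fun y => v y ^ 2 - 2 * c * v y) (hv2.sub (hv.const_mul _))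
    (integrable_const _), integral_sub hv2 (hv.const_mul _), integral_const_mul, integral_const,
    smul_eq_mul] at hn
  have h3 := mul_nonneg h0 hn
  have h4 := mul_nonneg (sub_nonneg.2 h1) (sq_nonneg (u - c))
  have h5 : c ^ 2 = c * (h * ∫ y, v y ∂ν + (1 - h * ν.real Set.univ) * u) := by rw [← hc]; ring
  nlinarith

/-- The difference operator commutes with a step because shifts commute. Jensen under the step,
followed by Fubini, moves the square inside. -/
theorem carre_step_le (hcomm : ∀ χ x y, T (T χ x) y = T (T χ y) x) (f : boundedMeasurable E)
    (χ : E) :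
    (carre hT ν (step hT ν h f) : E → ℝ) χ ≤ (step hT ν h (carre hT ν f) : E → ℝ) χ := by
  have hm : ∀ χ, Measurable (T χ) := fun χ => hT.comp measurable_prodMk_left
  have hm2 : Measurable fun p : X × X => T (T χ p.1) p.2 :=
    hT.comp (((hm χ).comp measurable_fst).prodMk measurable_snd)
  obtain ⟨C, hC0, hC⟩ := exists_bound f
  -- `v x y` is the difference in direction x at the state shifted by y; `u x` below is the one at χ
  -- itself.
  let v : X → X → ℝ := fun x y => (f : E → ℝ) (T (T χ x) y) - (f : E → ℝ) (T χ y)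
  have hvm : Measurable (Function.uncurry v) :=
    ((measurable_coe f).comp hm2).sub ((measurable_coe f).comp ((hm χ).comp measurable_snd))
  have hvb : ∀ x y, |v x y| ≤ C + C := fun x y => (abs_sub _ _).trans (add_le_add (hC _) (hC _))
  have hvi : ∀ x, Integrable (v x) ν := fun x =>
    (integrable_comp f (hm _)).sub (integrable_comp f (hm _))
  have hvb2 : ∀ x y, ‖v x y ^ 2‖ ≤ (C + C) ^ 2 := fun x y => by
    rw [norm_pow]
    exact pow_le_pow_left₀ (norm_nonneg _) (hvb x y) 2
  have hvi2 : Integrable (fun p : X × X => v p.1 p.2 ^ 2) (ν.prod ν) :=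
    Integrable.of_bound (hvm.pow_const 2).aestronglyMeasurable _
      (Filter.Eventually.of_forall fun p => hvb2 p.1 p.2)
  have hvi3 : ∀ x, Integrable (fun y => v x y ^ 2) ν := fun x =>
    Integrable.of_bound ((hvm.pow_const 2).comp measurable_prodMk_left).aestronglyMeasurable _
      (Filter.Eventually.of_forall fun p => hvb2 x p)
  let u : X → ℝ := fun x => (f : E → ℝ) (T χ x) - (f : E → ℝ) χ
  have hui : Integrable (fun x => u x ^ 2) ν := by
    refine Integrable.of_bound
      ((((measurable_coe f).comp (hm χ)).sub_const _).pow_const 2).aestronglyMeasurable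
      ((C + C) ^ 2) (Filter.Eventually.of_forall fun p => ?_)
    rw [norm_pow]
    exact pow_le_pow_left₀ (norm_nonneg _) ((abs_sub _ _).trans (add_le_add (hC _) (hC _))) 2
  have key : ∀ x, (step hT ν h f : E → ℝ) (T χ x) - (step hT ν h f : E → ℝ) χ =
      h * ∫ y, v x y ∂ν + (1 - h * ν.real Set.univ) * u x := by
    intro x
    rw [integral_sub (integrable_comp f (hm _)) (integrable_comp f (hm _)), step_apply, step_apply,
      shiftIntegral_apply, shiftIntegral_apply]
    ring
  have key2 : (carre hT ν (step hT ν h f) : E → ℝ) χ =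
      ∫ x, (h * ∫ y, v x y ∂ν + (1 - h * ν.real Set.univ) * u x) ^ 2 ∂ν := by
    rw [carre_apply]
    exact integral_congr_ae (Filter.Eventually.of_forall fun x => congrArg (· ^ 2) (key x))
  rw [key2, step_apply, shiftIntegral_apply, carre_apply]
  simp_rw [carre_apply]
  -- Exchanging the names of x and y turns the difference in direction y at the state shifted by x
  -- into `v`; this is where commutativity enters.
  have hswap : ∫ x, ∫ y, ((f : E → ℝ) (T (T χ x) y) - (f : E → ℝ) (T χ x)) ^ 2 ∂ν ∂ν =
      ∫ x, ∫ y, v x y ^ 2 ∂ν ∂ν := by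
    rw [integral_integral_swap (f := fun x y => v x y ^ 2) hvi2]
    refine integral_congr_ae (Filter.Eventually.of_forall fun y => integral_congr_ae
      (Filter.Eventually.of_forall fun x => ?_))
    dsimp only [v]
    rw [hcomm χ y x]
  rw [hswap, ← integral_const_mul, ← integral_const_mul,
    ← integral_add (hvi2.integral_prod_left.const_mul _) (hui.const_mul _)]
  refine integral_mono_of_nonneg (Filter.Eventually.of_forall fun _ => sq_nonneg _)
    ((hvi2.integral_prod_left.const_mul _).add (hui.const_mul _))
    (Filter.Eventually.of_forall fun x => ?_)
  exact sq_convex_integral_le ν h0 h1 (hvi x) (hvi3 x)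

/-- With K the step, K^{n+1}f² - (K^{n+1}f)² splits into K^n(Kf² - (Kf)²), controlled by one step,
and the n-step variance of Kf, controlled by induction. The factor 1 - hΛ pays for replacing K^nΓf
by K^{n+1}Γf, and it tends to 1 in the limit. -/
theorem step_pow_variance_le (hcomm : ∀ χ x y, T (T χ x) y = T (T χ y) x) (n : ℕ)
    (f : boundedMeasurable E) (χ : E) :
    (1 - h * ν.real Set.univ) * (((step hT ν h ^ n) (f ^ 2) : E → ℝ) χ -
      ((step hT ν h ^ n) f : E → ℝ) χ ^ 2) ≤
      n * h * ((step hT ν h ^ n) (carre hT ν f) : E → ℝ) χ := by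
  induction n generalizing f with
  | zero => simp
  | succ n ih =>
    have hc : 0 ≤ 1 - h * ν.real Set.univ := by linarith
    have e1 := step_pow_mono hT ν h0 h1 n (step_sq_sub_sq_le hT ν f (h := h)) χ
    have e2 := ih (step hT ν h f)
    have e3 := step_pow_mono hT ν h0 h1 n (carre_step_le hT ν h0 h1 hcomm f) χ
    -- A step keeps the current state with weight 1 - hΛ, so Kg ≥ (1 - hΛ)g for g ≥ 0.
    have e4 : (1 - h * ν.real Set.univ) * ((step hT ν h ^ n) (carre hT ν f) : E → ℝ) χ ≤
        ((step hT ν h ^ n) (step hT ν h (carre hT ν f)) : E → ℝ) χ := by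
      have := step_pow_mono hT ν h0 h1 n (f := (1 - h * ν.real Set.univ) • carre hT ν f)
        (g := step hT ν h (carre hT ν f)) (fun χ => ?_) χ
      · simpa using this
      · rw [step_apply]
        have := mul_nonneg h0 (shiftIntegral_nonneg hT ν (carre_nonneg hT ν f) χ)
        simpa using this
    rw [map_sub, map_smul] at e1
    simp only [pow_succ (step hT ν h) n, Module.End.mul_apply]
    simp only [AddSubgroupClass.coe_sub, Pi.sub_apply, Subalgebra.coe_smul, Pi.smul_apply,
      smul_eq_mul] at e1
    have e5 := mul_le_mul_of_nonneg_left e1 hc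
    have e6 := mul_le_mul_of_nonneg_left e4 h0
    have e7 := mul_le_mul_of_nonneg_left e3 (mul_nonneg (Nat.cast_nonneg (α := ℝ) n) h0)
    push_cast
    linarith

omit h0 h1

-- This is (1 + (A - Λ)/n)^n → e^{A-Λ}. The binomial expansion converges term by term, dominated by
-- CΛ^k/k!.
open Filter Topology in
theorem tendsto_step_pow (g : boundedMeasurable E) (χ : E) :
    Tendsto (fun n : ℕ => ((step hT ν (1 / n) ^ n) g : E → ℝ) χ) atTop
      (𝓝 (∑' k : ℕ, Real.exp (-ν.real Set.univ) / k.factorial *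
        ((shiftIntegral hT ν ^ k) g : E → ℝ) χ)) := by
  obtain ⟨C, hC0, hC⟩ := exists_bound g
  set Λ := ν.real Set.univ with hΛ
  have hΛ0 : 0 ≤ Λ := measureReal_nonneg
  set a : ℕ → ℝ := fun k => ((shiftIntegral hT ν ^ k) g : E → ℝ) χ with ha
  have hab : ∀ k, |a k| ≤ C * Λ ^ k := fun k => abs_shiftIntegral_pow_le hT ν g k hC χ
  have hexp : ∀ n : ℕ, ((step hT ν (1 / n) ^ n) g : E → ℝ) χ =
      ∑' k : ℕ, (n.choose k : ℝ) * (1 / n : ℝ) ^ k * (1 - Λ / n) ^ (n - k) * a k := by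
    intro n
    rw [tsum_eq_sum (s := Finset.range (n + 1))]
    · rw [step, Commute.add_pow (((Commute.one_right _).smul_right _).smul_left _)]
      simp only [LinearMap.sum_apply, AddSubmonoidClass.coe_finsetSum, Finset.sum_apply]
      refine Finset.sum_congr rfl fun k _ => ?_
      have : ((n.choose k : ℕ) : Module.End ℝ (boundedMeasurable E)) = (n.choose k : ℝ) • 1 := by
        ext; simp
      rw [this, smul_pow, smul_pow, one_pow]
      simp only [mul_smul_comm, mul_one, LinearMap.smul_apply, Subalgebra.coe_smul,
        Pi.smul_apply, smul_eq_mul, ha]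
      ring
    · intro k hk
      rw [Nat.choose_eq_zero_of_lt (by simpa using hk)]
      simp
  simp_rw [hexp]
  refine tendsto_tsum_of_dominated_convergence (bound := fun k : ℕ => C * (Λ ^ k / k.factorial))
    ((Real.summable_pow_div_factorial Λ).mul_left C) (fun k => ?_) ?_
  · refine Tendsto.mul_const _ ?_
    have t1 : Tendsto (fun n : ℕ => (n.choose k : ℝ) * (1 / n : ℝ) ^ k) atTop
        (𝓝 (1 ^ k / k.factorial)) := by
      refine tendsto_choose_mul_pow_atTop k ?_
      refine tendsto_const_nhds.congr' ?_
      filter_upwards [eventually_ge_atTop 1] with n hn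
      field_simp
    have t2 : Tendsto (fun n : ℕ => (1 - Λ / n)) atTop (𝓝 1) := by
      simpa using tendsto_const_nhds.sub (tendsto_const_div_atTop_nhds_zero_nat Λ)
    -- The natural subtraction is harmless, as only n ≥ k matters here: divide (1 - Λ/n)^n by (1 -
    -- Λ/n)^k.
    have t3 : Tendsto (fun n : ℕ => (1 - Λ / n) ^ (n - k)) atTop (𝓝 (Real.exp (-Λ))) := by
      have t4 := (Real.tendsto_one_add_div_pow_exp (-Λ)).div (t2.pow k) (by simp)
      rw [one_pow, div_one] at t4
      refine t4.congr' ?_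
      filter_upwards [eventually_ge_atTop k, t2.eventually_ne one_ne_zero] with n hn hn'
      simp only [Pi.div_apply]
      rw [pow_sub₀ _ hn' hn, neg_div, ← sub_eq_add_neg]
      rfl
    have := t1.mul t3
    rwa [one_pow, div_mul_eq_mul_div, one_mul] at this
  · filter_upwards [(tendsto_const_div_atTop_nhds_zero_nat Λ).eventually_le_const one_pos,
      eventually_ge_atTop 1] with n hn hn1 k
    have hn0 : (0 : ℝ) < n := by exact_mod_cast hn1
    have c1 : (n.choose k : ℝ) * (1 / n : ℝ) ^ k ≤ 1 / k.factorial := by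
      have := Nat.choose_le_pow_div (α := ℝ) k n
      calc (n.choose k : ℝ) * (1 / n : ℝ) ^ k ≤ (n ^ k / k.factorial) * (1 / n : ℝ) ^ k := by gcongr
        _ = 1 / k.factorial := by rw [one_div_pow]; field_simp
    have c2 : (1 - Λ / n) ^ (n - k) ≤ 1 :=
      pow_le_one₀ (by linarith) (by linarith [div_nonneg hΛ0 hn0.le])
    have c3 : 0 ≤ (1 - Λ / n) ^ (n - k) := pow_nonneg (by linarith) _
    rw [norm_mul, Real.norm_eq_abs, Real.norm_eq_abs, abs_of_nonneg (by positivity)]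
    calc (n.choose k : ℝ) * (1 / n : ℝ) ^ k * (1 - Λ / n) ^ (n - k) * |a k|
        ≤ 1 / k.factorial * 1 * (C * Λ ^ k) := by
          gcongr
          exact hab k
      _ = _ := by ring

/-! ### The law after a Poisson number of shifts -/

/-- The measure `A^k` applied to the point mass at `χ₀`. -/
noncomputable def iterLaw (T : E → X → E) (χ₀ : E) (ν : Measure X) : ℕ → Measure E
  | 0 => Measure.dirac χ₀
  | k + 1 => ((iterLaw T χ₀ ν k).prod ν).map (Function.uncurry T)

instance (χ₀ : E) (k : ℕ) : IsFiniteMeasure (iterLaw T χ₀ ν k) := by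
  induction k with
  | zero => rw [iterLaw]; infer_instance
  | succ k ih => rw [iterLaw]; infer_instance

/-- The law of the state obtained from `χ₀` after a Poisson number of random shifts. -/
noncomputable def poissonShiftLaw (T : E → X → E) (χ₀ : E) (ν : Measure X) : Measure E :=
  Measure.sum fun k : ℕ =>
    ENNReal.ofReal (Real.exp (-ν.real Set.univ) / k.factorial) • iterLaw T χ₀ ν k

include hT in
theorem iterLaw_univ (χ₀ : E) (k : ℕ) : iterLaw T χ₀ ν k Set.univ = ν Set.univ ^ k := by
  induction k with
  | zero => simp [iterLaw]
  | succ k ih =>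
    rw [iterLaw, Measure.map_apply hT MeasurableSet.univ, Set.preimage_univ,
      ← Set.univ_prod_univ, Measure.prod_prod, ih, pow_succ]

include hT in
theorem isProbabilityMeasure_poissonShiftLaw (χ₀ : E) :
    IsProbabilityMeasure (poissonShiftLaw T χ₀ ν) := by
  constructor
  rw [poissonShiftLaw, Measure.sum_apply _ MeasurableSet.univ]
  have hs := (NormedSpace.expSeries_div_hasSum_exp (ν.real Set.univ)).mul_left
    (Real.exp (-ν.real Set.univ))
  rw [← Real.exp_eq_exp_ℝ, ← Real.exp_add, neg_add_cancel, Real.exp_zero] at hs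
  have : ∀ k : ℕ, (ENNReal.ofReal (Real.exp (-ν.real Set.univ) / k.factorial) •
      iterLaw T χ₀ ν k) Set.univ =
      ENNReal.ofReal (Real.exp (-ν.real Set.univ) * (ν.real Set.univ ^ k / k.factorial)) := by
    intro k
    rw [Measure.smul_apply, iterLaw_univ hT, smul_eq_mul, ← ofReal_measureReal,
      ← ENNReal.ofReal_pow measureReal_nonneg, ← ENNReal.ofReal_mul (by positivity)]
    congr 1
    ring
  simp_rw [this]
  rw [← ENNReal.ofReal_tsum_of_nonneg (fun k => by positivity) hs.summable, hs.tsum_eq,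
    ENNReal.ofReal_one]

/-- Duality: the last shift of the law is the first operator applied to the test function. -/
theorem integral_iterLaw (χ₀ : E) (k : ℕ) (g : boundedMeasurable E) :
    ∫ χ, (g : E → ℝ) χ ∂iterLaw T χ₀ ν k = ((shiftIntegral hT ν ^ k) g : E → ℝ) χ₀ := by
  induction k generalizing g with
  | zero =>
    rw [iterLaw, integral_dirac' _ _ (measurable_coe g).stronglyMeasurable]
    rfl
  | succ k ih =>
    rw [iterLaw, integral_map hT.aemeasurable (measurable_coe g).aestronglyMeasurable,
      integral_prod _ (integrable_comp g hT), pow_succ, Module.End.mul_apply, ← ih]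
    rfl

theorem integral_poissonShiftLaw (χ₀ : E) (g : boundedMeasurable E) :
    ∫ χ, (g : E → ℝ) χ ∂poissonShiftLaw T χ₀ ν =
      ∑' k : ℕ, Real.exp (-ν.real Set.univ) / k.factorial *
        ((shiftIntegral hT ν ^ k) g : E → ℝ) χ₀ := by
  have := isProbabilityMeasure_poissonShiftLaw hT ν χ₀
  have hi : Integrable (g : E → ℝ) (poissonShiftLaw T χ₀ ν) := integrable_comp g measurable_id
  rw [poissonShiftLaw] at hi ⊢
  rw [integral_sum_measure hi]
  refine tsum_congr fun k => ?_
  rw [integral_smul_measure, integral_iterLaw hT, ENNReal.toReal_ofReal (by positivity),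
    smul_eq_mul]

open Filter Topology in
/-- The Poincaré inequality for a Poisson number of commuting random shifts. -/
theorem poissonShiftLaw_variance_le (hcomm : ∀ χ x y, T (T χ x) y = T (T χ y) x)
    (χ₀ : E) (f : boundedMeasurable E) :
    ∫ χ, (f : E → ℝ) χ ^ 2 ∂poissonShiftLaw T χ₀ ν -
      (∫ χ, (f : E → ℝ) χ ∂poissonShiftLaw T χ₀ ν) ^ 2 ≤
      ∫ χ, (carre hT ν f : E → ℝ) χ ∂poissonShiftLaw T χ₀ ν := by
  have hsq : ∫ χ, (f : E → ℝ) χ ^ 2 ∂poissonShiftLaw T χ₀ ν =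
      ∫ χ, ((f ^ 2 : boundedMeasurable E) : E → ℝ) χ ∂poissonShiftLaw T χ₀ ν := rfl
  rw [hsq]
  simp_rw [integral_poissonShiftLaw hT]
  -- With h = 1/n the factor nh is 1, and the factor on the variance side tends to 1.
  have t0 : Tendsto (fun n : ℕ => 1 - 1 / (n : ℝ) * ν.real Set.univ) atTop (𝓝 1) := by
    have := (tendsto_const_div_atTop_nhds_zero_nat (ν.real Set.univ)).const_sub 1
    simp only [sub_zero] at this
    refine this.congr fun n => ?_
    ring
  have t1 := t0.mul ((tendsto_step_pow hT ν (f ^ 2) χ₀).sub ((tendsto_step_pow hT ν f χ₀).pow 2))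
  rw [one_mul] at t1
  refine le_of_tendsto_of_tendsto t1 (tendsto_step_pow hT ν (carre hT ν f) χ₀) ?_
  filter_upwards [eventually_ge_atTop 1,
    (tendsto_const_div_atTop_nhds_zero_nat (ν.real Set.univ)).eventually_le_const one_pos]
    with n hn hn'
  have hn0 : (0 : ℝ) < n := by exact_mod_cast hn
  have := step_pow_variance_le hT ν (h := 1 / n) (by positivity)
    (by rw [one_div_mul_eq_div]; exact hn') hcomm n f χ₀
  rwa [mul_one_div_cancel hn0.ne', one_mul] at this

end boundedMeasurable

/-! ### Configurations, and uniqueness of their laws -/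

namespace PointMeasure

universe u

variable {X : Type u} [MeasurableSpace X]

theorem measurable_apply {B : Set X} (hB : MeasurableSet B) :
    Measurable fun χ : PointMeasure X => χ.1 B :=
  (Measure.measurable_coe hB).comp measurable_subtype_coe

theorem measurable_of_apply {Y : Type*} [MeasurableSpace Y] {f : Y → PointMeasure X}
    (h : ∀ B, MeasurableSet B → Measurable fun y => (f y).1 B) : Measurable f :=
  Measurable.subtype_mk (Measure.measurable_of_measurable_coe _ h)

/-- The empty configuration. -/
noncomputable instance : Zero (PointMeasure X) :=
  ⟨⟨0, inferInstance, fun _ _ => Or.inr ⟨0, by simp⟩⟩⟩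

/-- The superposition of two configurations. -/
noncomputable instance : Add (PointMeasure X) where
  add χ χ' := ⟨χ.1 + χ'.1, by
    have := χ.2.1
    have := χ'.2.1
    refine ⟨inferInstance, fun B hB => ?_⟩
    rw [Measure.add_apply]
    rcases χ.2.2 B hB with h | ⟨k, h⟩
    · left
      simp [h]
    rcases χ'.2.2 B hB with h' | ⟨k', h'⟩
    · left
      simp [h']
    · exact Or.inr ⟨k + k', by simp [h, h']⟩⟩

/-- The restriction of a configuration to a measurable set. -/
noncomputable def restrict (χ : PointMeasure X) {S : Set X} (hS : MeasurableSet S) :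
    PointMeasure X :=
  ⟨χ.1.restrict S, by
    have := χ.2.1
    refine ⟨inferInstance, fun B hB => ?_⟩
    rw [Measure.restrict_apply hB]
    exact χ.2.2 _ (hB.inter hS)⟩

theorem coe_zero : (0 : PointMeasure X).1 = 0 := rfl

theorem coe_add (χ χ' : PointMeasure X) : (χ + χ').1 = χ.1 + χ'.1 := rfl

theorem add_apply (χ χ' : PointMeasure X) (B : Set X) : (χ + χ').1 B = χ.1 B + χ'.1 B := rfl

theorem coe_addDirac (χ : PointMeasure X) (x : X) :
    (χ.addDirac x).1 = χ.1 + Measure.dirac x := rfl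

theorem restrict_apply (χ : PointMeasure X) {S B : Set X} (hS : MeasurableSet S)
    (hB : MeasurableSet B) : (χ.restrict hS).1 B = χ.1 (B ∩ S) := Measure.restrict_apply hB

theorem addDirac_apply (χ : PointMeasure X) (x : X) {B : Set X} (hB : MeasurableSet B) :
    (χ.addDirac x).1 B = χ.1 B + B.indicator 1 x := by
  rw [coe_addDirac, Measure.add_apply, Measure.dirac_apply' x hB]

theorem addDirac_comm (χ : PointMeasure X) (x y : X) :
    (χ.addDirac x).addDirac y = (χ.addDirac y).addDirac x := by
  apply Subtype.ext
  simp only [coe_addDirac]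
  rw [add_assoc, add_assoc, add_comm (Measure.dirac x)]

theorem addDirac_add (χ χ' : PointMeasure X) (x : X) :
    χ.addDirac x + χ' = (χ + χ').addDirac x := by
  apply Subtype.ext
  simp only [coe_addDirac, coe_add]
  rw [add_assoc, add_assoc, add_comm (Measure.dirac x)]

theorem measurable_addDirac :
    Measurable (Function.uncurry (addDirac : PointMeasure X → X → PointMeasure X)) := by
  refine measurable_of_apply fun B hB => ?_
  simp only [Function.uncurry, addDirac_apply _ _ hB]
  exact ((measurable_apply hB).comp measurable_fst).add
    ((measurable_one.indicator hB).comp measurable_snd)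

theorem measurable_add : Measurable fun p : PointMeasure X × PointMeasure X => p.1 + p.2 := by
  refine measurable_of_apply fun B hB => ?_
  simp only [add_apply]
  exact ((measurable_apply hB).comp measurable_fst).add ((measurable_apply hB).comp measurable_snd)

theorem measurable_restrict {S : Set X} (hS : MeasurableSet S) :
    Measurable fun χ : PointMeasure X => χ.restrict hS := by
  refine measurable_of_apply fun B hB => ?_
  simp only [restrict_apply _ hS hB]
  exact measurable_apply (hB.inter hS)

/-- Continuity from below. It allows testing only sets inside some `S n`, where counts are almost
surely finite. -/
theorem measurable_of_apply_inter {Y : Type*} [MeasurableSpace Y] {f : Y → PointMeasure X}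
    {S : ℕ → Set X} (hmono : Monotone S) (hU : ⋃ n, S n = Set.univ)
    (h : ∀ B, MeasurableSet B → ∀ n, Measurable fun y => (f y).1 (B ∩ S n)) : Measurable f := by
  refine measurable_of_apply fun B hB => ?_
  have hsup : ∀ χ : PointMeasure X, χ.1 B = ⨆ n, χ.1 (B ∩ S n) := by
    intro χ
    rw [← Monotone.measure_iUnion fun m n hmn => Set.inter_subset_inter_right _ (hmono hmn),
      ← Set.inter_iUnion, hU, Set.inter_univ]
  simp only [hsup]
  exact Measurable.iSup (h B hB)

/-- The linear statistic `χ ↦ ∑ i, t i * χ (B i)`. -/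
noncomputable def linearCount {ι : Type*} [Fintype ι] (B : ι → Set X) (t : ι → ℝ)
    (χ : PointMeasure X) : ℝ := ∑ i, t i * (χ.1 (B i)).toReal

theorem measurable_linearCount {ι : Type*} [Fintype ι] {B : ι → Set X}
    (hB : ∀ i, MeasurableSet (B i)) (t : ι → ℝ) : Measurable (linearCount B t) :=
  Finset.measurable_fun_sum _ fun i _ => ((measurable_apply (hB i)).ennreal_toReal).const_mul _

/-- The characteristic functional of the law of a point process. -/
noncomputable def charFunctional (Q : Measure (PointMeasure X)) {ι : Type*} [Fintype ι]
    (B : ι → Set X) (t : ι → ℝ) : ℂ :=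
  ∫ χ, Complex.exp (linearCount B t χ * Complex.I) ∂Q

/-- The law of a point process that is finite on the sets of an increasing exhausting sequence
is determined by its characteristic functional on these sets. -/
theorem ext_of_charFunctional {Q Q' : Measure (PointMeasure X)} [IsProbabilityMeasure Q]
    [IsProbabilityMeasure Q'] {S : ℕ → Set X} (hS : ∀ n, MeasurableSet (S n)) (hmono : Monotone S)
    (hU : ⋃ n, S n = Set.univ) (hQ : ∀ n, ∀ᵐ χ ∂Q, χ.1 (S n) ≠ ⊤)
    (hQ' : ∀ n, ∀ᵐ χ ∂Q', χ.1 (S n) ≠ ⊤)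
    (h : ∀ (ι : Type u) [Fintype ι] (B : ι → Set X) (t : ι → ℝ), (∀ i, MeasurableSet (B i)) →
      (∀ i, ∃ n, B i ⊆ S n) → charFunctional Q B t = charFunctional Q' B t) : Q = Q' := by
  classical
  let G : Type u := {B : Set X // MeasurableSet B ∧ ∃ n, B ⊆ S n}
  let e : PointMeasure X → G → ENNReal := fun χ B => χ.1 B.1
  have he : Measurable e := measurable_pi_lambda _ fun B => measurable_apply B.2.1
  have hfin : ∀ I : Finset G, (Q.map e).map I.restrict = (Q'.map e).map I.restrict := by
    intro I
    let r : PointMeasure X → I → ℝ := fun χ B => (χ.1 B.1.1).toReal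
    have hr : Measurable r :=
      measurable_pi_lambda _ fun B => (measurable_apply B.1.2.1).ennreal_toReal
    have hmap : Q.map r = Q'.map r := by
      have := Measure.isProbabilityMeasure_map (μ := Q) hr.aemeasurable
      have := Measure.isProbabilityMeasure_map (μ := Q') hr.aemeasurable
      -- A functional of finitely many counts is a linear statistic whose coefficients are its
      -- values on the unit vectors (Cramér–Wold).
      refine Measure.ext_of_charFunDual (funext fun L => ?_)
      have hL : ∀ χ, L (r χ) = linearCount (fun B : I => B.1.1) (fun B => L (Pi.single B 1)) χ := by
        intro χ
        conv_lhs => rw [pi_eq_sum_univ' (r χ)]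
        rw [map_sum]
        refine Finset.sum_congr rfl fun B _ => ?_
        rw [map_smul, smul_eq_mul, mul_comm]
      have hm : Measurable fun v : I → ℝ => Complex.exp (L v * Complex.I) := by fun_prop
      rw [charFunDual_apply, charFunDual_apply,
        integral_map hr.aemeasurable hm.aestronglyMeasurable,
        integral_map hr.aemeasurable hm.aestronglyMeasurable]
      simp_rw [hL]
      exact h I _ _ (fun B => B.1.2.1) fun B => B.1.2.2
    have hof : Measurable fun (v : I → ℝ) (B : I) => ENNReal.ofReal (v B) :=
      measurable_pi_lambda _ fun B => (measurable_pi_apply B).ennreal_ofReal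
    -- Passing to real counts would lose the value ∞, but on sets inside some `S n` that value has
    -- probability zero.
    have key : ∀ V : Measure (PointMeasure X), (∀ n, ∀ᵐ χ ∂V, χ.1 (S n) ≠ ⊤) →
        (V.map e).map I.restrict =
          (V.map r).map fun (v : I → ℝ) (B : I) => ENNReal.ofReal (v B) := by
      intro V hV
      rw [Measure.map_map (Finset.measurable_restrict I) he, Measure.map_map hof hr]
      refine Measure.map_congr ?_
      filter_upwards [ae_all_iff.2 hV] with χ hχ
      ext B
      obtain ⟨n, hn⟩ := B.1.2.2
      exact (ENNReal.ofReal_toReal (ne_top_of_le_ne_top (hχ n) (measure_mono hn))).symm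
    rw [key Q hQ, key Q' hQ', hmap]
  have hmap : Q.map e = Q'.map e := by
    have := Measure.isProbabilityMeasure_map (μ := Q) he.aemeasurable
    have : ∀ I : Finset G, IsFiniteMeasure ((Q.map e).map I.restrict) := fun I => inferInstance
    exact IsProjectiveLimit.unique (P := fun I : Finset G => (Q.map e).map I.restrict)
      (fun I => rfl) (fun I => (hfin I).symm)
  have hle : (inferInstance : MeasurableSpace (PointMeasure X)) ≤
      MeasurableSpace.comap e MeasurableSpace.pi := by
    have : @Measurable _ _ (MeasurableSpace.comap e MeasurableSpace.pi) _
        (id : PointMeasure X → PointMeasure X) :=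
      @measurable_of_apply_inter X _ _ (MeasurableSpace.comap e MeasurableSpace.pi) _ S hmono hU
        fun B hB n => (measurable_pi_apply
          (⟨B ∩ S n, hB.inter (hS n), n, Set.inter_subset_right⟩ : G)).comp (comap_measurable e)
    intro D hD
    exact this hD
  ext D hD
  obtain ⟨D', hD', rfl⟩ := hle D hD
  rw [← Measure.map_apply he hD', ← Measure.map_apply he hD', hmap]

end PointMeasure

/-! ### Step functions and the characteristic functional of a Poisson process -/

namespace PointMeasure

variable {X : Type*} [MeasurableSpace X] {ι : Type*} [Fintype ι]

/-- The step function `x ↦ ∑ i, t i * 1_{B i}(x)`. -/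
noncomputable def stepFunction (B : ι → Set X) (t : ι → ℝ) (x : X) : ℝ :=
  ∑ i, t i * (B i).indicator 1 x

theorem measurable_stepFunction {B : ι → Set X} (hB : ∀ i, MeasurableSet (B i)) (t : ι → ℝ) :
    Measurable (stepFunction B t) :=
  Finset.measurable_fun_sum _ fun i _ => (measurable_one.indicator (hB i)).const_mul _

omit [MeasurableSpace X] in
theorem finite_range_stepFunction (B : ι → Set X) (t : ι → ℝ) :
    (Set.range (stepFunction B t)).Finite := by
  classical
  refine (Set.finite_range fun s : ι → Bool => ∑ i, t i * if s i then 1 else 0).subset ?_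
  rintro _ ⟨x, rfl⟩
  exact ⟨fun i => decide (x ∈ B i), by simp [stepFunction, Set.indicator_apply]⟩

theorem integral_stepFunction {B : ι → Set X} (hB : ∀ i, MeasurableSet (B i)) (t : ι → ℝ)
    {χ : Measure X} (hχ : ∀ i, χ (B i) ≠ ⊤) :
    ∫ x, stepFunction B t x ∂χ = ∑ i, t i * (χ (B i)).toReal := by
  have hint : ∀ i, Integrable ((B i).indicator (1 : X → ℝ)) χ := fun i =>
    (integrable_indicator_iff (hB i)).2 (integrableOn_const (hχ i))
  simp only [stepFunction]
  rw [integral_finsetSum _ fun i _ => (hint i).const_mul _]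
  refine Finset.sum_congr rfl fun i _ => ?_
  rw [integral_const_mul, integral_indicator_one (hB i)]
  rfl

/-- A step function can be written with disjoint level sets. -/
theorem exists_disjoint_levels {B : ι → Set X} (hB : ∀ i, MeasurableSet (B i)) (t : ι → ℝ) :
    ∃ (m : ℕ) (v : Fin m → ℝ) (D : Fin m → Set X), (∀ j, MeasurableSet (D j)) ∧
      (∀ i j, i ≠ j → Disjoint (D i) (D j)) ∧ (∀ j, D j ⊆ ⋃ i, B i) ∧
      ∀ (M : Type) [AddCommMonoid M] (g : ℝ → M), g 0 = 0 → ∀ x,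
        g (stepFunction B t x) = ∑ j, (D j).indicator (fun _ => g (v j)) x := by
  classical
  -- Dropping the level 0 keeps every level set inside the union of the `B i`, hence of finite
  -- measure; this is why `g 0 = 0` is required.
  let V : Finset ℝ := (finite_range_stepFunction B t).toFinset.erase 0
  let v : Fin V.card → ℝ := fun j => V.equivFin.symm j
  have hv0 : ∀ j, v j ≠ 0 := fun j => Finset.ne_of_mem_erase (V.equivFin.symm j).2
  have hvinj : Function.Injective v := Subtype.val_injective.comp V.equivFin.symm.injective
  refine ⟨V.card, v, fun j => stepFunction B t ⁻¹' {v j},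
    fun j => measurable_stepFunction hB t (measurableSet_singleton _), fun i j hij => ?_,
    fun j x hx => ?_, fun M _ g hg x => ?_⟩
  · exact Disjoint.preimage _ (Set.disjoint_singleton.2 (hvinj.ne hij))
  · by_contra hn
    refine hv0 j ?_
    rw [← Set.mem_singleton_iff.1 hx]
    refine Finset.sum_eq_zero fun i _ => ?_
    rw [Set.indicator_of_notMem fun h => hn (Set.mem_iUnion.2 ⟨i, h⟩), mul_zero]
  · by_cases h0 : stepFunction B t x = 0
    · rw [h0, hg]
      refine (Finset.sum_eq_zero fun j _ => Set.indicator_of_notMem (fun h => hv0 j ?_) _).symm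
      rw [← Set.mem_singleton_iff.1 h, h0]
    · have hmem : stepFunction B t x ∈ V := by
        simp [V, h0]
      have hvj : v (V.equivFin ⟨_, hmem⟩) = stepFunction B t x := by simp [v]
      rw [Finset.sum_eq_single (V.equivFin ⟨_, hmem⟩)]
      · rw [Set.indicator_of_mem, hvj]
        exact hvj.symm
      · intro j _ hj
        refine Set.indicator_of_notMem (fun h => hj (hvinj ?_)) _
        rw [hvj]
        exact (Set.mem_singleton_iff.1 h).symm
      · simp

theorem measurable_exp_stepFunction {B : ι → Set X} (hB : ∀ i, MeasurableSet (B i)) (t : ι → ℝ) :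
    Measurable fun x => Complex.exp (stepFunction B t x * Complex.I) :=
  Complex.measurable_exp.comp
    ((Complex.measurable_ofReal.comp (measurable_stepFunction hB t)).mul_const _)

theorem measurable_exp_linearCount {B : ι → Set X} (hB : ∀ i, MeasurableSet (B i)) (t : ι → ℝ) :
    Measurable fun χ : PointMeasure X => Complex.exp (linearCount B t χ * Complex.I) :=
  Complex.measurable_exp.comp
    ((Complex.measurable_ofReal.comp (measurable_linearCount hB t)).mul_const _)

/-- The logarithm of the characteristic functional of a Poisson process. -/
noncomputable def poissonExponent (μ : Measure X) (B : ι → Set X) (t : ι → ℝ) : ℂ :=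
  ∫ x, (Complex.exp (stepFunction B t x * Complex.I) - 1) ∂μ

theorem integrable_exp_stepFunction_sub_one {B : ι → Set X} (hB : ∀ i, MeasurableSet (B i))
    (t : ι → ℝ) {μ : Measure X} (hμ : ∀ i, μ (B i) ≠ ⊤) :
    Integrable (fun x => Complex.exp (stepFunction B t x * Complex.I) - 1) μ := by
  obtain ⟨m, v, D, hD, -, hDB, hrep⟩ := exists_disjoint_levels hB t
  have : (fun x => Complex.exp (stepFunction B t x * Complex.I) - 1) = fun x =>
      ∑ j, (D j).indicator (fun _ => Complex.exp (v j * Complex.I) - 1) x := by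
    ext x
    exact hrep ℂ (fun r => Complex.exp (r * Complex.I) - 1) (by simp) x
  rw [this]
  refine integrable_finsetSum _ fun j _ => (integrable_indicator_iff (hD j)).2
    (integrableOn_const (ne_top_of_le_ne_top ?_ (measure_mono (hDB j))))
  exact ((measure_iUnion_fintype_le μ B).trans_lt (ENNReal.sum_lt_top.2 fun i _ =>
    (hμ i).lt_top)).ne

section Poisson

variable {Ω : Type*} [MeasurableSpace Ω] {P : Measure Ω} [IsProbabilityMeasure P] {μ : Measure X}
  {η : Ω → PointMeasure X}

/-- The Poisson weights of the finite values already sum to 1, so nothing is left for ∞. -/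
theorem _root_.IsPoissonProcess.ae_ne_top (hη : IsPoissonProcess P μ η) {B : Set X}
    (hB : MeasurableSet B) (hμB : μ B ≠ ⊤) : ∀ᵐ ω ∂P, (η ω).1 B ≠ ⊤ := by
  have hm : Measurable fun ω => (η ω).1 B := (measurable_apply hB).comp hη.measurable
  have hU : {ω | (η ω).1 B ≠ ⊤} = ⋃ k : ℕ, {ω | (η ω).1 B = (k : ENNReal)} := by
    ext ω
    simp only [Set.mem_ofPred_eq, Set.mem_iUnion]
    constructor
    · exact fun h => ((η ω).2.2 B hB).resolve_left h
    · rintro ⟨k, hk⟩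
      simp [hk]
  have hone : P {ω | (η ω).1 B ≠ ⊤} = 1 := by
    rw [hU, measure_iUnion]
    · simp_rw [hη.poisson B hB hμB]
      have hs := hasSum_one_poissonMeasure (μ B).toNNReal
      rw [← ENNReal.ofReal_tsum_of_nonneg]
      · rw [← ENNReal.ofReal_one, ← hs.tsum_eq]
        congr 2
        ext k
        simp only [ENNReal.coe_toNNReal_eq_toReal]
        ring
      · intro k
        positivity
      · refine hs.summable.congr fun k => ?_
        simp only [ENNReal.coe_toNNReal_eq_toReal]
        ring
    · intro i j hij
      refine Set.disjoint_left.2 fun ω hi hj => hij ?_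
      have : (i : ENNReal) = j := Eq.trans (Eq.symm hi) hj
      exact_mod_cast this
    · exact fun k => hm (measurableSet_singleton _)
  exact (prob_compl_eq_zero_iff (hm (measurableSet_singleton ⊤).compl)).2 hone

theorem _root_.IsPoissonProcess.integral_exp_apply (hη : IsPoissonProcess P μ η) {B : Set X}
    (hB : MeasurableSet B) (hμB : μ B ≠ ⊤) (v : ℝ) :
    ∫ ω, Complex.exp (v * ((η ω).1 B).toReal * Complex.I) ∂P =
      Complex.exp ((μ B).toReal * (Complex.exp (v * Complex.I) - 1)) := by
  have hm : Measurable fun ω => (η ω).1 B := (measurable_apply hB).comp hη.measurable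
  let M : Ω → ℕ := fun ω => ⌊((η ω).1 B).toReal⌋₊
  have hM : Measurable M := Nat.measurable_floor.comp hm.ennreal_toReal
  have hfin := hη.ae_ne_top hB hμB
  have hnat : ∀ᵐ ω ∂P, (η ω).1 B = (M ω : ENNReal) := by
    filter_upwards [hfin] with ω hω
    obtain ⟨k, hk⟩ := ((η ω).2.2 B hB).resolve_left hω
    simp [M, hk]
  have hlaw : P.map M = poissonMeasure (μ B).toNNReal := by
    refine Measure.ext_of_singleton fun k => ?_
    rw [Measure.map_apply hM (measurableSet_singleton k), poissonMeasure_singleton]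
    have : (M ⁻¹' {k} : Set Ω) =ᵐ[P] {ω | (η ω).1 B = (k : ENNReal)} := by
      filter_upwards [hnat] with ω hω
      refine propext ?_
      change M ω = k ↔ (η ω).1 B = (k : ENNReal)
      rw [hω]
      norm_cast
    rw [measure_congr this, hη.poisson B hB hμB]
    congr 1
    simp only [ENNReal.coe_toNNReal_eq_toReal]
    ring
  have h1 : ∫ ω, Complex.exp (v * ((η ω).1 B).toReal * Complex.I) ∂P =
      ∫ ω, Complex.exp (v * (M ω : ℝ) * Complex.I) ∂P := by
    refine integral_congr_ae ?_
    filter_upwards [hnat] with ω hω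
    rw [hω]
    simp
  have h2 := charFun_map_cast_poissonMeasure (μ B).toNNReal v
  rw [charFun_apply_real, integral_map .of_discrete (by fun_prop), ← hlaw,
    integral_map hM.aemeasurable (by fun_prop)] at h2
  rw [h1, h2]
  rfl

/-- The characteristic functional of a Poisson process. -/
theorem _root_.IsPoissonProcess.charFunctional_map (hη : IsPoissonProcess P μ η) {B : ι → Set X}
    (hB : ∀ i, MeasurableSet (B i)) (t : ι → ℝ) (hμ : ∀ i, μ (B i) ≠ ⊤) :
    charFunctional (P.map η) B t = Complex.exp (poissonExponent μ B t) := by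
  obtain ⟨m, v, D, hD, hdisj, hDB, hrep⟩ := exists_disjoint_levels hB t
  have hDtop : ∀ (χ : Measure X), (∀ i, χ (B i) ≠ ⊤) → ∀ j, χ (D j) ≠ ⊤ := fun χ hχ j =>
    ne_top_of_le_ne_top ((measure_iUnion_fintype_le χ B).trans_lt (ENNReal.sum_lt_top.2 fun i _ =>
      (hχ i).lt_top)).ne (measure_mono (hDB j))
  -- Passing from overlapping to disjoint sets makes independence of the counts available.
  have hlin : ∀ (χ : Measure X), (∀ i, χ (B i) ≠ ⊤) →
      ∑ i, t i * (χ (B i)).toReal = ∑ j, v j * (χ (D j)).toReal := by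
    intro χ hχ
    rw [← integral_stepFunction hB t hχ, ← integral_stepFunction hD v (hDtop χ hχ)]
    congr 1
    ext x
    rw [show stepFunction B t x = id (stepFunction B t x) from rfl, hrep ℝ id rfl x]
    refine Finset.sum_congr rfl fun j _ => ?_
    by_cases hx : x ∈ D j <;> simp [hx]
  have hcount : ∀ j, Measurable fun ω => (η ω).1 (D j) := fun j =>
    (measurable_apply (hD j)).comp hη.measurable
  have hae : ∀ᵐ ω ∂P, ∀ i, (η ω).1 (B i) ≠ ⊤ := ae_all_iff.2 fun i => hη.ae_ne_top (hB i) (hμ i)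
  have hexp : Measurable fun p : ℝ × ENNReal =>
      Complex.exp (p.1 * (p.2.toReal : ℂ) * Complex.I) := by fun_prop
  rw [charFunctional, integral_map hη.measurable.aemeasurable
    (measurable_exp_linearCount hB t).aestronglyMeasurable]
  calc ∫ ω, Complex.exp (linearCount B t (η ω) * Complex.I) ∂P
      = ∫ ω, ∏ j, Complex.exp (v j * (((η ω).1 (D j)).toReal : ℂ) * Complex.I) ∂P := by
        refine integral_congr_ae ?_
        filter_upwards [hae] with ω hω
        rw [linearCount, hlin _ hω, ← Complex.exp_sum, Complex.ofReal_sum, Finset.sum_mul]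
        simp only [Complex.ofReal_mul]
    _ = ∏ j, ∫ ω, Complex.exp (v j * (((η ω).1 (D j)).toReal : ℂ) * Complex.I) ∂P :=
        iIndepFun.integral_fun_prod_comp
          (f := fun (j : Fin m) (y : ENNReal) => Complex.exp (v j * (y.toReal : ℂ) * Complex.I))
          (hη.indep_increments m D hD hdisj) (fun j => (hcount j).aemeasurable)
          fun j => (hexp.comp (measurable_prodMk_left (x := v j))).aestronglyMeasurable
    _ = ∏ j, Complex.exp ((μ (D j)).toReal * (Complex.exp (v j * Complex.I) - 1)) :=
        Finset.prod_congr rfl fun j _ => hη.integral_exp_apply (hD j) (hDtop μ hμ j) (v j)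
    _ = Complex.exp (poissonExponent μ B t) := by
        rw [← Complex.exp_sum, poissonExponent]
        congr 1
        have : (fun x => Complex.exp (stepFunction B t x * Complex.I) - 1) = fun x =>
            ∑ j, (D j).indicator (fun _ => Complex.exp (v j * Complex.I) - 1) x := by
          ext x
          exact hrep ℂ (fun r => Complex.exp (r * Complex.I) - 1) (by simp) x
        rw [this, integral_finsetSum]
        · refine Finset.sum_congr rfl fun j _ => ?_
          rw [integral_indicator_const _ (hD j), Complex.real_smul]
          rfl
        · exact fun j _ => (integrable_indicator_iff (hD j)).2
            (integrableOn_const (hDtop μ hμ j))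

end Poisson

/-! ### The characteristic functional of the finite Poisson law -/

section Shift

variable (ν : Measure X) [IsFiniteMeasure ν]

open boundedMeasurable

/-- The Poisson law with finite intensity measure `ν`, as a mixture of binomial processes. -/
noncomputable abbrev finitePoissonLaw : Measure (PointMeasure X) :=
  poissonShiftLaw (addDirac : PointMeasure X → X → PointMeasure X) 0 ν

omit [IsFiniteMeasure ν] in
theorem ae_iterLaw_ne_top (k : ℕ) :
    ∀ᵐ χ ∂iterLaw (addDirac : PointMeasure X → X → PointMeasure X) 0 ν k, χ.1 Set.univ ≠ ⊤ := by
  have hset : MeasurableSet {χ : PointMeasure X | χ.1 Set.univ ≠ ⊤} :=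
    measurable_apply MeasurableSet.univ (measurableSet_singleton ⊤).compl
  induction k with
  | zero =>
    rw [iterLaw, ae_dirac_iff hset]
    simp [coe_zero]
  | succ k ih =>
    rw [iterLaw, ae_map_iff measurable_addDirac.aemeasurable hset]
    filter_upwards [Measure.quasiMeasurePreserving_fst.ae ih] with p hp
    simp only [Function.uncurry, coe_addDirac, Measure.add_apply]
    simp [hp]

omit [IsFiniteMeasure ν] in
theorem ae_finitePoissonLaw_ne_top : ∀ᵐ χ ∂finitePoissonLaw ν, χ.1 Set.univ ≠ ⊤ := by
  rw [finitePoissonLaw, poissonShiftLaw, Measure.ae_sum_iff]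
  exact fun k => Measure.ae_smul_measure (ae_iterLaw_ne_top ν k) _

theorem linearCount_addDirac {B : ι → Set X} (hB : ∀ i, MeasurableSet (B i)) (t : ι → ℝ)
    {χ : PointMeasure X} (hχ : χ.1 Set.univ ≠ ⊤) (x : X) :
    linearCount B t (χ.addDirac x) = linearCount B t χ + stepFunction B t x := by
  rw [linearCount, linearCount, stepFunction, ← Finset.sum_add_distrib]
  refine Finset.sum_congr rfl fun i _ => ?_
  rw [addDirac_apply _ _ (hB i), ENNReal.toReal_add
    (ne_top_of_le_ne_top hχ (measure_mono (Set.subset_univ _)))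
    (by by_cases hx : x ∈ B i <;> simp [hx]), mul_add]
  congr 2
  by_cases hx : x ∈ B i <;> simp [hx]

/-- Each added point contributes an independent factor, since linear statistics are additive on
finite configurations. -/
theorem charFunctional_iterLaw {B : ι → Set X} (hB : ∀ i, MeasurableSet (B i)) (t : ι → ℝ)
    (k : ℕ) : charFunctional (iterLaw (addDirac : PointMeasure X → X → PointMeasure X) 0 ν k) B t =
      (∫ x, Complex.exp (stepFunction B t x * Complex.I) ∂ν) ^ k := by
  induction k with
  | zero =>
    rw [charFunctional, iterLaw,
      integral_dirac' _ _ (measurable_exp_linearCount hB t).stronglyMeasurable]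
    simp [linearCount, coe_zero]
  | succ k ih =>
    rw [charFunctional, iterLaw, integral_map measurable_addDirac.aemeasurable
      (measurable_exp_linearCount hB t).aestronglyMeasurable, pow_succ, ← ih, charFunctional,
      ← integral_prod_mul]
    refine integral_congr_ae ?_
    filter_upwards [Measure.quasiMeasurePreserving_fst.ae (ae_iterLaw_ne_top ν k)] with p hp
    rw [Function.uncurry, linearCount_addDirac hB t hp, ← Complex.exp_add, Complex.ofReal_add,
      add_mul]

theorem charFunctional_finitePoissonLaw {B : ι → Set X} (hB : ∀ i, MeasurableSet (B i))
    (t : ι → ℝ) :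
    charFunctional (finitePoissonLaw ν) B t = Complex.exp (poissonExponent ν B t) := by
  have := isProbabilityMeasure_poissonShiftLaw (measurable_addDirac (X := X)) ν 0
  have hi : Integrable (fun χ => Complex.exp (linearCount B t χ * Complex.I))
      (finitePoissonLaw ν) :=
    Integrable.of_bound (measurable_exp_linearCount hB t).aestronglyMeasurable 1
      (Filter.Eventually.of_forall fun χ => (Complex.norm_exp_ofReal_mul_I _).le)
  have hu : Integrable (fun x => Complex.exp (stepFunction B t x * Complex.I)) ν :=
    Integrable.of_bound (measurable_exp_stepFunction hB t).aestronglyMeasurable 1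
      (Filter.Eventually.of_forall fun χ => (Complex.norm_exp_ofReal_mul_I _).le)
  set z := ∫ x, Complex.exp (stepFunction B t x * Complex.I) ∂ν with hz
  have hexp : poissonExponent ν B t = -(ν.real Set.univ : ℂ) + z := by
    rw [poissonExponent, integral_sub hu (integrable_const _), integral_const]
    simp
    ring
  rw [hexp, Complex.exp_add, charFunctional]
  rw [finitePoissonLaw, poissonShiftLaw] at hi ⊢
  -- The mixture is e^{-Λ} Σ z^k/k! = e^{z-Λ}.
  have hsum : Complex.exp z = ∑' k : ℕ, z ^ k / k.factorial := by
    rw [Complex.exp_eq_exp_ℂ, NormedSpace.exp_eq_tsum_div]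
  rw [integral_sum_measure hi, hsum, ← tsum_mul_left]
  refine tsum_congr fun k => ?_
  rw [integral_smul_measure, ENNReal.toReal_ofReal (by positivity)]
  have := charFunctional_iterLaw ν hB t k
  rw [charFunctional] at this
  rw [this, Complex.real_smul]
  push_cast
  ring

end Shift

end PointMeasure

/-! ### Resampling the points inside a set of finite intensity -/

namespace PointMeasure

open boundedMeasurable

variable {X : Type*} [MeasurableSpace X] {Ω : Type*} [MeasurableSpace Ω] {P : Measure Ω}
  [IsProbabilityMeasure P] {μ : Measure X} {η : Ω → PointMeasure X}

/-- The superposition of `χ` with the part of `χ'` outside `S`. -/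
noncomputable def glue {S : Set X} (hS : MeasurableSet S)
    (p : PointMeasure X × PointMeasure X) : PointMeasure X := p.1 + p.2.restrict hS.compl

theorem measurable_glue {S : Set X} (hS : MeasurableSet S) : Measurable (glue hS) :=
  measurable_add.comp (measurable_fst.prodMk ((measurable_restrict hS.compl).comp measurable_snd))

theorem glue_apply {S : Set X} (hS : MeasurableSet S) (p : PointMeasure X × PointMeasure X)
    {B : Set X} (hB : MeasurableSet B) : (glue hS p).1 B = p.1.1 B + p.2.1 (B ∩ Sᶜ) := by
  rw [glue, add_apply, restrict_apply _ _ hB]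

theorem restrict_glue {S : Set X} (hS : MeasurableSet S) (p : PointMeasure X × PointMeasure X) :
    (glue hS p).restrict hS = p.1.restrict hS := by
  apply Subtype.ext
  ext B hB
  rw [restrict_apply _ _ hB, restrict_apply _ _ hB, glue_apply _ _ (hB.inter hS),
    Set.inter_assoc, Set.inter_compl_self, Set.inter_empty, measure_empty, add_zero]

theorem glue_addDirac {S : Set X} (hS : MeasurableSet S) (χ χ' : PointMeasure X) (x : X) :
    glue hS (χ.addDirac x, χ') = (glue hS (χ, χ')).addDirac x := addDirac_add _ _ _

/-- The step function of the sets cut to the complement of `S` vanishes on `S`, so there its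
integrand is e^0 - 1 = 0. -/
theorem poissonExponent_restrict_add {ι : Type*} [Fintype ι] {B : ι → Set X}
    (hB : ∀ i, MeasurableSet (B i)) (t : ι → ℝ) (hμ : ∀ i, μ (B i) ≠ ⊤) {S : Set X}
    (hS : MeasurableSet S) :
    poissonExponent (μ.restrict S) B t + poissonExponent μ (fun i => B i ∩ Sᶜ) t =
      poissonExponent μ B t := by
  have hi := integrable_exp_stepFunction_sub_one hB t hμ
  have : poissonExponent μ (fun i => B i ∩ Sᶜ) t = poissonExponent (μ.restrict Sᶜ) B t := by
    rw [poissonExponent, poissonExponent, ← integral_indicator hS.compl]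
    refine integral_congr_ae (Filter.Eventually.of_forall fun x => ?_)
    by_cases hx : x ∈ S
    · simp [stepFunction, hx]
    · have : ∀ i, (B i ∩ Sᶜ).indicator (1 : X → ℝ) x = (B i).indicator 1 x := fun i => by
        by_cases hxi : x ∈ B i <;> simp [hxi, hx]
      simp [stepFunction, hx, this]
  rw [this]
  exact integral_add_compl hS hi

/-- A Poisson process is the superposition of a finite Poisson process on `S` and an independent
copy of itself outside `S`. -/
theorem _root_.IsPoissonProcess.map_glue [SigmaFinite μ] (hη : IsPoissonProcess P μ η) {S : Set X}
    (hS : MeasurableSet S) (hμS : μ S ≠ ⊤) :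
    ((finitePoissonLaw (μ.restrict S)).prod (P.map η)).map (glue hS) = P.map η := by
  have : IsFiniteMeasure (μ.restrict S) := ⟨by simpa using hμS.lt_top⟩
  have := isProbabilityMeasure_poissonShiftLaw (measurable_addDirac (X := X)) (μ.restrict S) 0
  have := Measure.isProbabilityMeasure_map (μ := P) hη.measurable.aemeasurable
  have := Measure.isProbabilityMeasure_map
    (μ := (finitePoissonLaw (μ.restrict S)).prod (P.map η)) (measurable_glue hS).aemeasurable
  have hset : ∀ {B : Set X}, MeasurableSet B → MeasurableSet {χ : PointMeasure X | χ.1 B ≠ ⊤} :=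
    fun hB => measurable_apply hB (measurableSet_singleton ⊤).compl
  have hae : ∀ {B : Set X}, MeasurableSet B → μ B ≠ ⊤ → ∀ᵐ χ ∂P.map η, χ.1 B ≠ ⊤ :=
    fun hB h => (ae_map_iff hη.measurable.aemeasurable (hset hB)).2 (hη.ae_ne_top hB h)
  have hmsp := measurableSet_spanningSets μ
  have hfst := Measure.quasiMeasurePreserving_fst (ν := P.map η) |>.ae
    (ae_finitePoissonLaw_ne_top (μ.restrict S))
  refine ext_of_charFunctional hmsp (monotone_spanningSets μ) (iUnion_spanningSets μ) (fun n => ?_)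
    (fun n => hae (hmsp n) (measure_spanningSets_lt_top μ n).ne) fun ι _ B t hB hBS => ?_
  · rw [ae_map_iff (measurable_glue hS).aemeasurable (hset (hmsp n))]
    filter_upwards [hfst, Measure.quasiMeasurePreserving_snd.ae
      (hae (hmsp n) (measure_spanningSets_lt_top μ n).ne)] with p hp hp'
    rw [glue_apply _ _ (hmsp n)]
    exact ENNReal.add_ne_top.2 ⟨ne_top_of_le_ne_top hp (measure_mono (Set.subset_univ _)),
      ne_top_of_le_ne_top hp' (measure_mono Set.inter_subset_left)⟩
  · have hμB : ∀ i, μ (B i) ≠ ⊤ := fun i => by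
      obtain ⟨n, hn⟩ := hBS i
      exact ne_top_of_le_ne_top (measure_spanningSets_lt_top μ n).ne (measure_mono hn)
    have hB' : ∀ i, MeasurableSet (B i ∩ Sᶜ) := fun i => (hB i).inter hS.compl
    have hμB' : ∀ i, μ (B i ∩ Sᶜ) ≠ ⊤ := fun i =>
      ne_top_of_le_ne_top (hμB i) (measure_mono Set.inter_subset_left)
    -- The exponent splits over `S` and its complement, so the target factors as the characteristic
    -- functionals of the two independent parts.
    rw [hη.charFunctional_map hB t hμB, ← poissonExponent_restrict_add hB t hμB hS,
      Complex.exp_add, ← charFunctional_finitePoissonLaw _ hB t,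
      ← hη.charFunctional_map hB' t hμB', charFunctional, charFunctional, charFunctional,
      ← integral_prod_mul, integral_map (measurable_glue hS).aemeasurable
        (measurable_exp_linearCount hB t).aestronglyMeasurable]
    refine integral_congr_ae ?_
    filter_upwards [hfst, Measure.quasiMeasurePreserving_snd.ae
      (ae_all_iff.2 fun i => hae (hB' i) (hμB' i))] with p hp hp'
    rw [← Complex.exp_add, ← add_mul, ← Complex.ofReal_add, linearCount, linearCount, linearCount,
      ← Finset.sum_add_distrib]
    congr 3
    refine Finset.sum_congr rfl fun i _ => ?_
    rw [glue_apply _ _ (hB i), ENNReal.toReal_add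
      (ne_top_of_le_ne_top hp (measure_mono (Set.subset_univ _))) (hp' i), mul_add]

/-- A bounded function of the configuration with the outer part `χ'` frozen. -/
noncomputable def freeze {S : Set X} (hS : MeasurableSet S) (χ' : PointMeasure X)
    (f : boundedMeasurable (PointMeasure X)) : boundedMeasurable (PointMeasure X) :=
  ⟨fun χ => (f : PointMeasure X → ℝ) (glue hS (χ, χ')),
    (measurable_coe f).comp ((measurable_glue hS).comp measurable_prodMk_right),
    by
      obtain ⟨C, -, hC⟩ := exists_bound f
      exact ⟨C, fun χ => hC _⟩⟩

/-- Adding a point to the free part commutes with gluing on the frozen part. -/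
theorem carre_freeze {S : Set X} (hS : MeasurableSet S) (ν : Measure X) [IsFiniteMeasure ν]
    (χ' : PointMeasure X) (f : boundedMeasurable (PointMeasure X)) :
    carre measurable_addDirac ν (freeze hS χ' f) =
      freeze hS χ' (carre measurable_addDirac ν f) := by
  ext χ
  rw [carre_apply]
  simp only [freeze, glue_addDirac]
  rw [carre_apply]

/-- The Poincaré inequality on a set of finite intensity, with an error term that measures how
well `f` is approximated by a function `h` of the configuration in this set. -/
theorem _root_.IsPoissonProcess.variance_le_carre_add [SigmaFinite μ]
    (hη : IsPoissonProcess P μ η) {S : Set X} (hS : MeasurableSet S)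
    [IsFiniteMeasure (μ.restrict S)]
    (f h : boundedMeasurable (PointMeasure X))
    (hh : ∀ p, (h : PointMeasure X → ℝ) (glue hS p) = (h : PointMeasure X → ℝ) p.1) :
    ∫ χ, (f : PointMeasure X → ℝ) χ ^ 2 ∂P.map η - (∫ χ, (f : PointMeasure X → ℝ) χ ∂P.map η) ^ 2 ≤
      ∫ χ, (carre measurable_addDirac (μ.restrict S) f : PointMeasure X → ℝ) χ ∂P.map η +
      ∫ χ, ((f : PointMeasure X → ℝ) χ - (h : PointMeasure X → ℝ) χ) ^ 2 ∂P.map η := by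
  have hμS : μ S ≠ ⊤ := by
    have := measure_ne_top (μ.restrict S) Set.univ
    rwa [Measure.restrict_apply_univ] at this
  have hglue := hη.map_glue hS hμS
  set Q := P.map η with hQ
  set V := finitePoissonLaw (μ.restrict S) with hV
  have : IsProbabilityMeasure V :=
    isProbabilityMeasure_poissonShiftLaw (measurable_addDirac (X := X)) (μ.restrict S) 0
  have : IsProbabilityMeasure Q := Measure.isProbabilityMeasure_map hη.measurable.aemeasurable
  have hprod : ∀ g : boundedMeasurable (PointMeasure X), ∫ χ, (g : PointMeasure X → ℝ) χ ∂Q =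
      ∫ χ', ∫ χ, (g : PointMeasure X → ℝ) (glue hS (χ, χ')) ∂V ∂Q := by
    intro g
    conv_lhs => rw [← hglue]
    rw [integral_map (measurable_glue hS).aemeasurable (measurable_coe g).aestronglyMeasurable,
      integral_prod_symm _ (integrable_comp g (measurable_glue hS))]
  have hint : ∀ g : boundedMeasurable (PointMeasure X),
      Integrable (fun χ' => ∫ χ, (g : PointMeasure X → ℝ) (glue hS (χ, χ')) ∂V) Q := fun g =>
    (integrable_comp g (ν := V.prod Q) (measurable_glue hS)).integral_prod_right
  -- `a` is the mean of `f` given the outer part. `hfirst` bounds the mean conditional variance,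
  -- `hsecond` the variance of `a`.
  set a : PointMeasure X → ℝ := fun χ' => ∫ χ, (f : PointMeasure X → ℝ) (glue hS (χ, χ')) ∂V with ha
  have hami : Integrable a Q := hint f
  obtain ⟨C, hC0, hC⟩ := exists_bound f
  have ha2 : Integrable (fun χ' => a χ' ^ 2) Q := by
    refine Integrable.of_bound (hami.aestronglyMeasurable.pow 2) (C ^ 2)
      (Filter.Eventually.of_forall fun χ' => ?_)
    rw [norm_pow]
    refine pow_le_pow_left₀ (norm_nonneg _) ?_ 2
    have := norm_integral_le_of_norm_le_const (μ := V)
      (f := fun χ => (f : PointMeasure X → ℝ) (glue hS (χ, χ')))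
      (Filter.Eventually.of_forall fun χ => hC _)
    simpa using this
  have hfirst : ∫ χ, (f : PointMeasure X → ℝ) χ ^ 2 ∂Q - ∫ χ', a χ' ^ 2 ∂Q ≤
      ∫ χ, (carre measurable_addDirac (μ.restrict S) f : PointMeasure X → ℝ) χ ∂Q := by
    have e1 := hprod (f ^ 2)
    have e2 := hprod (carre measurable_addDirac (μ.restrict S) f)
    rw [show ∫ χ, (f : PointMeasure X → ℝ) χ ^ 2 ∂Q = _ from e1, e2, ← integral_sub (hint _) ha2]
    refine integral_mono ((hint _).sub ha2) (hint _) fun χ' => ?_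
    have := poissonShiftLaw_variance_le (measurable_addDirac (X := X)) (μ.restrict S)
      addDirac_comm 0 (freeze hS χ' f)
    rw [carre_freeze] at this
    exact this
  have hsecond : ∫ χ', a χ' ^ 2 ∂Q - (∫ χ, (f : PointMeasure X → ℝ) χ ∂Q) ^ 2 ≤
      ∫ χ, ((f : PointMeasure X → ℝ) χ - (h : PointMeasure X → ℝ) χ) ^ 2 ∂Q := by
    -- As `h` ignores the outer part, c is also its conditional mean; the variance of `a` is at most
    -- its second moment about c.
    set c := ∫ χ, (h : PointMeasure X → ℝ) χ ∂V with hc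
    have e1 : ∫ χ, (f : PointMeasure X → ℝ) χ ∂Q = ∫ χ', a χ' ∂Q := hprod f
    have e2 : ∫ χ', (a χ' - c) ^ 2 ∂Q = ∫ χ', a χ' ^ 2 ∂Q - 2 * c * ∫ χ', a χ' ∂Q + c ^ 2 := by
      have : (fun χ' => (a χ' - c) ^ 2) = fun χ' => (a χ' ^ 2 - 2 * c * a χ') + c ^ 2 := by
        ext χ'
        ring
      rw [this, integral_add (f := fun χ' => a χ' ^ 2 - 2 * c * a χ')
        (ha2.sub (hami.const_mul _)) (integrable_const _),
        integral_sub ha2 (hami.const_mul _), integral_const_mul]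
      simp
    have e3 : ∫ χ', (a χ' - c) ^ 2 ∂Q ≤
        ∫ χ, (((f - h) ^ 2 : boundedMeasurable (PointMeasure X)) : PointMeasure X → ℝ) χ ∂Q := by
      rw [hprod]
      refine integral_mono_of_nonneg (Filter.Eventually.of_forall fun _ => sq_nonneg _)
        (hint _) (Filter.Eventually.of_forall fun χ' => ?_)
      have hgm : Measurable fun χ : PointMeasure X => glue hS (χ, χ') :=
        (measurable_glue hS).comp measurable_prodMk_right
      have e4 : a χ' - c = ∫ χ, ((f - h : boundedMeasurable (PointMeasure X)) :
          PointMeasure X → ℝ) (glue hS (χ, χ')) ∂V := by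
        have : ∀ χ, ((f - h : boundedMeasurable (PointMeasure X)) : PointMeasure X → ℝ)
            (glue hS (χ, χ')) = (f : PointMeasure X → ℝ) (glue hS (χ, χ')) -
              (h : PointMeasure X → ℝ) χ := fun χ => by
          rw [← hh (χ, χ')]
          rfl
        simp_rw [this]
        have hhi : Integrable (h : PointMeasure X → ℝ) V := integrable_comp h measurable_id
        rw [integral_sub (integrable_comp f hgm) hhi]
      -- With total mass 1 and h = 1 the point `u` has weight zero, leaving the plain inequality (∫
      -- v)² ≤ ∫ v².
      have e5 := sq_convex_integral_le V (h := 1) zero_le_one (by simp) (u := 0)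
        (integrable_comp (f - h) hgm) (integrable_comp ((f - h) ^ 2) hgm)
      simp only [one_mul, mul_zero, add_zero, ne_eq, OfNat.ofNat_ne_zero, not_false_eq_true,
        zero_pow] at e5
      change (a χ' - c) ^ 2 ≤ _
      rw [e4]
      exact e5
    have e6 : ∫ χ, (((f - h) ^ 2 : boundedMeasurable (PointMeasure X)) : PointMeasure X → ℝ) χ ∂Q =
      ∫ χ, ((f : PointMeasure X → ℝ) χ - (h : PointMeasure X → ℝ) χ) ^ 2 ∂Q := rfl
    rw [e6, e2] at e3
    rw [e1]
    nlinarith [sq_nonneg (∫ χ', a χ' ∂Q - c)]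
  linarith

end PointMeasure

/-! ### Exhaustion of the space and truncation -/

namespace PointMeasure

open boundedMeasurable Filter Topology

/-- Truncation of a real number at the levels `-C` and `C`. -/
noncomputable def clip (C r : ℝ) : ℝ := max (-C) (min r C)

theorem abs_clip_le {C : ℝ} (hC : 0 ≤ C) (r : ℝ) : |clip C r| ≤ C :=
  abs_le.2 ⟨le_max_left _ _, max_le (by linarith) (min_le_right _ _)⟩

theorem clip_eq_self {C r : ℝ} (h : |r| ≤ C) : clip C r = r := by
  rw [clip, min_eq_left (abs_le.1 h).2, max_eq_right (abs_le.1 h).1]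

theorem continuous_clip (C : ℝ) : Continuous (clip C) :=
  continuous_const.max (continuous_id.min continuous_const)

theorem abs_clip_sub_clip_le (C r s : ℝ) : |clip C r - clip C s| ≤ |r - s| := by
  refine (abs_max_sub_max_le_max _ _ _ _).trans ?_
  rw [sub_self, abs_zero]
  refine max_le (abs_nonneg _) ((abs_min_sub_min_le_max _ _ _ _).trans ?_)
  rw [sub_self, abs_zero]
  exact max_le le_rfl (abs_nonneg _)

variable {X : Type*} [MeasurableSpace X] {Ω : Type*} [MeasurableSpace Ω] {P : Measure Ω}
  [IsProbabilityMeasure P] {μ : Measure X} {η : Ω → PointMeasure X}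

/-- The filtration of the restrictions to an increasing sequence of sets. -/
noncomputable def restrictFiltration {S : ℕ → Set X} (hS : ∀ n, MeasurableSet (S n))
    (hmono : Monotone S) : Filtration ℕ (inferInstance : MeasurableSpace (PointMeasure X)) where
  seq n := MeasurableSpace.comap (fun χ => χ.restrict (hS n)) inferInstance
  mono' m n hmn := by
    have : (fun χ : PointMeasure X => χ.restrict (hS m)) =
        (fun χ => χ.restrict (hS m)) ∘ fun χ => χ.restrict (hS n) := by
      ext χ B hB
      simp only [Function.comp]
      rw [restrict_apply _ _ hB, restrict_apply _ _ hB, restrict_apply _ _ (hB.inter (hS m)),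
        Set.inter_assoc, Set.inter_eq_left.2 (hmono hmn)]
    change MeasurableSpace.comap _ _ ≤ _
    rw [this, ← MeasurableSpace.comap_comp]
    exact MeasurableSpace.comap_mono (measurable_restrict (hS m)).comap_le
  le' n := (measurable_restrict (hS n)).comap_le

theorem le_iSup_restrictFiltration {S : ℕ → Set X} (hS : ∀ n, MeasurableSet (S n))
    (hmono : Monotone S) (hU : ⋃ n, S n = Set.univ) :
    (inferInstance : MeasurableSpace (PointMeasure X)) ≤
      ⨆ n, restrictFiltration hS hmono n := by
  have : @Measurable _ _ (⨆ n, restrictFiltration hS hmono n) _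
      (id : PointMeasure X → PointMeasure X) := by
    refine @measurable_of_apply_inter X _ _ (⨆ n, restrictFiltration hS hmono n) _ S hmono hU
      fun B hB n => ?_
    have h1 : (fun χ : PointMeasure X => χ.1 (B ∩ S n)) =
        (fun χ : PointMeasure X => χ.1 B) ∘ fun χ => χ.restrict (hS n) := by
      ext χ
      exact (restrict_apply _ _ hB).symm
    refine Measurable.mono ?_ (le_iSup (fun n => restrictFiltration hS hmono n) n) le_rfl
    change @Measurable _ _ (MeasurableSpace.comap (fun χ => χ.restrict (hS n)) inferInstance) _
      (fun χ : PointMeasure X => χ.1 (B ∩ S n))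
    rw [h1]
    exact (measurable_apply hB).comp (comap_measurable _)
  intro D hD
  exact this hD

/-- The integrand is nonnegative, so enlarging `S` to the whole space only increases the integral.
-/
theorem ofReal_integral_carre_le (f : boundedMeasurable (PointMeasure X)) {S : Set X}
    [IsFiniteMeasure (μ.restrict S)] (Q : Measure (PointMeasure X)) [IsFiniteMeasure Q] :
    ENNReal.ofReal (∫ χ, (carre measurable_addDirac (μ.restrict S) f : PointMeasure X → ℝ) χ ∂Q) ≤
      ∫⁻ χ, ∫⁻ x, ENNReal.ofReal (differenceOp x f χ ^ 2) ∂μ ∂Q := by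
  have hint : Integrable (carre measurable_addDirac (μ.restrict S) f : PointMeasure X → ℝ) Q :=
    integrable_comp _ measurable_id
  rw [ofReal_integral_eq_lintegral_ofReal hint (Eventually.of_forall fun χ => carre_nonneg _ _ _ _)]
  refine lintegral_mono fun χ => ?_
  have hm : Measurable (χ.addDirac) := measurable_addDirac.comp measurable_prodMk_left
  obtain ⟨C, hC0, hC⟩ := exists_bound f
  rw [carre_apply, ofReal_integral_eq_lintegral_ofReal]
  · exact lintegral_mono' Measure.restrict_le_self le_rfl
  · refine Integrable.of_bound ((((measurable_coe f).comp hm).sub_const _).pow_const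
      2).aestronglyMeasurable ((C + C) ^ 2) (Eventually.of_forall fun p => ?_)
    rw [norm_pow]
    exact pow_le_pow_left₀ (norm_nonneg _) ((abs_sub _ _).trans (add_le_add (hC _) (hC _))) 2
  · exact Eventually.of_forall fun _ => sq_nonneg _

/-- The Poincaré inequality for bounded functions of a Poisson process. -/
theorem _root_.IsPoissonProcess.ofReal_variance_le [SigmaFinite μ] (hη : IsPoissonProcess P μ η)
    (f : boundedMeasurable (PointMeasure X)) :
    ENNReal.ofReal (∫ χ, (f : PointMeasure X → ℝ) χ ^ 2 ∂P.map η -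
      (∫ χ, (f : PointMeasure X → ℝ) χ ∂P.map η) ^ 2) ≤
      ∫⁻ χ, ∫⁻ x, ENNReal.ofReal (differenceOp x f χ ^ 2) ∂μ ∂P.map η := by
  have : IsProbabilityMeasure (P.map η) :=
    Measure.isProbabilityMeasure_map hη.measurable.aemeasurable
  set Q := P.map η with hQ
  have hS := measurableSet_spanningSets μ
  have hmono := monotone_spanningSets μ
  let ℱ := restrictFiltration hS hmono
  obtain ⟨C, hC0, hC⟩ := exists_bound f
  have hfi : Integrable (f : PointMeasure X → ℝ) Q := integrable_comp f measurable_id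
  let h' : ℕ → PointMeasure X → ℝ := fun n => Q[(f : PointMeasure X → ℝ)|ℱ n]
  have hh'm : ∀ n, Measurable[ℱ n] (h' n) := fun n => stronglyMeasurable_condExp.measurable
  -- A conditional expectation is bounded only almost everywhere; clipping bounds it everywhere and
  -- preserves the limit because |f| ≤ C.
  let h : ℕ → boundedMeasurable (PointMeasure X) := fun n =>
    ⟨fun χ => clip C (h' n χ),
      (continuous_clip C).measurable.comp ((hh'm n).mono (ℱ.le n) le_rfl),
      C, fun χ => abs_clip_le hC0 _⟩
  have hh : ∀ n p, (h n : PointMeasure X → ℝ) (glue (hS n) p) =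
      (h n : PointMeasure X → ℝ) p.1 := by
    intro n p
    -- Measurability with respect to the restriction makes `h' n` a function of it, and gluing does
    -- not alter the restriction.
    exact congrArg (clip C) ((hh'm n).factorsThrough (restrict_glue (hS n) p))
  have hlim : ∀ᵐ χ ∂Q, Tendsto (fun n => (h n : PointMeasure X → ℝ) χ) atTop
      (𝓝 ((f : PointMeasure X → ℝ) χ)) := by
    have hf : StronglyMeasurable[⨆ n, ℱ n] (f : PointMeasure X → ℝ) :=
      ((measurable_coe f).mono (le_iSup_restrictFiltration hS hmono (iUnion_spanningSets μ))
        le_rfl).stronglyMeasurable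
    filter_upwards [hfi.tendsto_ae_condExp (ℱ := ℱ) hf] with χ hχ
    have := ((continuous_clip C).tendsto _).comp hχ
    rwa [clip_eq_self (hC χ)] at this
  have herr : Tendsto (fun n => ∫ χ, ((f : PointMeasure X → ℝ) χ -
      (h n : PointMeasure X → ℝ) χ) ^ 2 ∂Q) atTop (𝓝 0) := by
    have := tendsto_integral_of_dominated_convergence (μ := Q)
      (F := fun n χ => ((f : PointMeasure X → ℝ) χ - (h n : PointMeasure X → ℝ) χ) ^ 2)
      (f := fun _ => (0 : ℝ)) (fun _ => (C + C) ^ 2)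
      (fun n => (((measurable_coe f).sub (measurable_coe (h n))).pow_const
        2).aestronglyMeasurable) (integrable_const _) (fun n => Eventually.of_forall fun χ => ?_) ?_
    · simpa using this
    · rw [norm_pow]
      exact pow_le_pow_left₀ (norm_nonneg _) ((abs_sub _ _).trans
        (add_le_add (hC _) (abs_clip_le hC0 _))) 2
    · filter_upwards [hlim] with χ hχ
      simpa using (hχ.const_sub ((f : PointMeasure X → ℝ) χ)).pow 2
  have hbound : ∀ n, ENNReal.ofReal (∫ χ, (f : PointMeasure X → ℝ) χ ^ 2 ∂Q -
      (∫ χ, (f : PointMeasure X → ℝ) χ ∂Q) ^ 2) ≤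
      ∫⁻ χ, ∫⁻ x, ENNReal.ofReal (differenceOp x f χ ^ 2) ∂μ ∂Q +
      ENNReal.ofReal (∫ χ, ((f : PointMeasure X → ℝ) χ - (h n : PointMeasure X → ℝ) χ) ^ 2 ∂Q) := by
    intro n
    have : IsFiniteMeasure (μ.restrict (spanningSets μ n)) :=
      ⟨by simpa using measure_spanningSets_lt_top μ n⟩
    refine (ENNReal.ofReal_le_ofReal (hη.variance_le_carre_add (hS n) f (h n) (hh n))).trans
      (ENNReal.ofReal_add_le.trans ?_)
    gcongr
    exact ofReal_integral_carre_le f Q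
  have ht := (ENNReal.tendsto_ofReal herr).const_add
    (∫⁻ χ, ∫⁻ x, ENNReal.ofReal (differenceOp x f χ ^ 2) ∂μ ∂Q)
  rw [ENNReal.ofReal_zero, add_zero] at ht
  exact ge_of_tendsto' ht hbound

/-- The Poincaré inequality for square integrable functions of a Poisson process. -/
theorem _root_.IsPoissonProcess.evariance_map_le [SigmaFinite μ] (hη : IsPoissonProcess P μ η)
    {f : PointMeasure X → ℝ} (hf : Measurable f) (hf2 : MemLp f 2 (P.map η)) :
    evariance f (P.map η) ≤
      ∫⁻ χ, ∫⁻ x, ENNReal.ofReal (differenceOp x f χ ^ 2) ∂μ ∂P.map η := by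
  have : IsProbabilityMeasure (P.map η) :=
    Measure.isProbabilityMeasure_map hη.measurable.aemeasurable
  set Q := P.map η with hQ
  let g : ℕ → boundedMeasurable (PointMeasure X) := fun n =>
    ⟨fun χ => clip n (f χ), (continuous_clip n).measurable.comp hf, n,
      fun χ => abs_clip_le n.cast_nonneg _⟩
  have hgf : ∀ n χ, |(g n : PointMeasure X → ℝ) χ| ≤ |f χ| := fun n χ => by
    have := abs_clip_sub_clip_le n (f χ) 0
    rwa [clip_eq_self (r := 0) (by simp), sub_zero, sub_zero] at this
  have hlim : ∀ χ, Tendsto (fun n => (g n : PointMeasure X → ℝ) χ) atTop (𝓝 (f χ)) := fun χ => by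
    refine tendsto_const_nhds.congr' ?_
    obtain ⟨N, hN⟩ := exists_nat_ge |f χ|
    filter_upwards [eventually_ge_atTop N] with n hn
    exact (clip_eq_self (hN.trans (by exact_mod_cast hn))).symm
  have t1 : Tendsto (fun n => ∫ χ, (g n : PointMeasure X → ℝ) χ ∂Q) atTop (𝓝 (∫ χ, f χ ∂Q)) :=
    tendsto_integral_of_dominated_convergence (fun χ => |f χ|)
      (fun n => (measurable_coe (g n)).aestronglyMeasurable)
      (hf2.integrable one_le_two).abs (fun n => Eventually.of_forall (hgf n))
      (Eventually.of_forall hlim)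
  have t2 : Tendsto (fun n => ∫ χ, (g n : PointMeasure X → ℝ) χ ^ 2 ∂Q) atTop
      (𝓝 (∫ χ, f χ ^ 2 ∂Q)) := by
    refine tendsto_integral_of_dominated_convergence (fun χ => f χ ^ 2)
      (fun n => ((measurable_coe (g n)).pow_const 2).aestronglyMeasurable)
      hf2.integrable_sq (fun n => Eventually.of_forall fun χ => ?_)
      (Eventually.of_forall fun χ => (hlim χ).pow 2)
    rw [norm_pow, ← sq_abs (f χ)]
    exact pow_le_pow_left₀ (norm_nonneg _) (hgf n χ) 2
  rw [← ofReal_variance hf2, variance_eq_sub hf2]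
  -- Clipping is 1-Lipschitz, so it shrinks every difference: the right side bounds all truncations
  -- at once, and only the variance needs a limit.
  refine le_of_tendsto' (ENNReal.tendsto_ofReal (t2.sub (t1.pow 2))) fun n =>
    (hη.ofReal_variance_le (g n)).trans (lintegral_mono fun χ => lintegral_mono fun x =>
      ENNReal.ofReal_le_ofReal (sq_le_sq.2 (abs_clip_sub_clip_le _ _ _)))

end PointMeasure

/-- Poincaré inequality for Poisson processes. For a representative `f` of `F`, the random variable
`D_x F` is `D_x f (η)`; the inequality is asserted for every representative. Both sides are
elements of `[0, ∞]`. -/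
theorem theorem11 {X Ω : Type*} [MeasurableSpace X] [MeasurableSpace Ω]
    (P : Measure Ω) [IsProbabilityMeasure P] (μ : Measure X) [SigmaFinite μ]
    (η : Ω → PointMeasure X) (hη : IsPoissonProcess P μ η)
    (F : Ω → ℝ) (hF : MemL2Eta P η F) :
    ∀ f : PointMeasure X → ℝ, IsRepresentative P η F f →
      evariance F P ≤
        ∫⁻ ω, ∫⁻ x, ENNReal.ofReal ((differenceOp x f (η ω)) ^ 2) ∂μ ∂P := by
  rintro f ⟨hf, hFf⟩
  have hηm := hη.measurable
  have hL2 : MemLp f 2 (P.map η) :=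
    (memLp_map_measure_iff hf.aestronglyMeasurable hηm.aemeasurable).2 ((memLp_congr_ae hFf).1 hF.1)
  -- Measurability of the inner integral in χ is needed to carry the bound from the law of `η` back
  -- to `P`.
  have hD : Measurable fun χ => ∫⁻ x, ENNReal.ofReal (differenceOp x f χ ^ 2) ∂μ := by
    refine Measurable.lintegral_prod_right' (f := fun p : PointMeasure X × X =>
      ENNReal.ofReal (differenceOp p.2 f p.1 ^ 2)) ?_
    exact (((hf.comp PointMeasure.measurable_addDirac).sub
      (hf.comp measurable_fst)).pow_const 2).ennreal_ofReal
  have hvar : evariance F P = evariance f (P.map η) := by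
    rw [evariance_congr (Y := f ∘ η) hFf, ← ofReal_variance hL2, variance_map hf.aemeasurable
      hηm.aemeasurable, ofReal_variance]
    exact (memLp_map_measure_iff hf.aestronglyMeasurable hηm.aemeasurable).1 hL2
  rw [hvar]
  refine (hη.evariance_map_le hf hL2).trans ?_
  rw [lintegral_map hD hηm]
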